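/- **Setting.** Let $\|\cdot\|$ be a norm on $\mathbb R^d$ with dual norm $\|v\|_*=\sup_{\|x\|\le 1}\langle v,x\rangle$, and let $A:\mathbb R^d\to\mathbb R^d$ be monotone, $\langle A(x)-A(y),x-y\rangle\ge 0$, and $L$-Lipschitz, $\|A(x)-A(y)\|_*\le L\|x-y\|$. Assume that the variational inequality $\langle A(x^\star),x-x^\star\rangle\ge 0$ for all $x\in\mathbb R^d$ has a solution $x^\star$. Let $g(x;\omega)$, $\omega\sim\mathbb P$, be a stochastic oracle with relative noise, i.e. $\mathbb E[g(x;\omega)]=A(x)$ and $\mathbb E\|g(x;\omega)-A(x)\|_*^2\le\sigma_R\|A(x)\|_*^2$ for every $x$, and with $\|g(x;\omega)\|_*\le J$ almost surely for every $x$. Co-coercivity is not assumed. **Quantization.** A level sequence is $0=\ell_0<\ell_1<\dots<\ell_\alpha<\ell_{\alpha+1}=1$. For $u\in[0,1]$ lying between consecutive levels $\ell_\tau\le u\le\ell_{\tau+1}$, random rounding $q_\ell(u)$ returns $\ell_{\tau+1}$ with probability $\xi(u)=(u-\ell_\tau)/(\ell_{\tau+1}-\ell_\tau)$ and $\ell_\tau$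 otherwise. A layer-wise scheme $\mathbb L$ assigns one of $M$ types to every coordinate and a level sequence $\ell^m$ (with $\alpha_m$ interior levels) to every type $m$; for an integer $q\ge 1$, $Q_{\mathbb L}(v)_i=\|v\|_q\,\mathrm{sign}(v_i)\,q_{\ell^{m}}(|v_i|/\|v\|_q)$ with $m$ the type of $i$ and independent roundings of the coordinates. With $\bar\ell=\max_m\max_{1\le j\le\alpha_m}\ell^m_{j+1}/\ell^m_j$ (and $\bar\ell=1$ if there are no interior levels), $\bar\ell_1=\max_m\ell_1^m$ and $d_{th}=(2/\bar\ell_1)^{\min\{2,q\}}$, its variance bound is $$\varepsilon_Q=\frac{(\bar\ell-1)^2}{4\bar\ell}+\big(\bar\ell_1d^{1/\min\{q,2\}}-1\big)\mathbf 1\{d\ge d_{th}\}+\frac{\bar\ell_1^2}{4}d^{2/\min\{q,2\}}\mathbf 1\{d<d_{th}\}.$$ **Algorithm (QODA).** There are $K\ge1$ nodes. Let $\hat q\in(0,1/4]$, $X_1\in\mathbb R^d$, $Y_1=0$, $\hat V_{k,1/2}=0$, and for $t\ge 1$ $$X_{t+1/2}=X_t-\frac{\gamma_t}{K}\sum_{k=1}^K\hat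 V_{k,t-1/2},\quad \hat V_{k,t+1/2}=Q_{\mathbb L_t}\big(g(X_{t+1/2};\omega_{k,t})\big),\quad Y_{t+1}=Y_t-\frac1K\sum_{k=1}^K\hat V_{k,t+1/2},\quad X_{t+1}=X_1+\eta_{t+1}Y_{t+1},$$ $$\gamma_t=\Big(1+\sum_{s=1}^{t-2}\sum_{k=1}^K\frac{\|\hat V_{k,s+1/2}\|_*^2}{K^2}\Big)^{\hat q-\frac12},\qquad \eta_t=\Big(1+\sum_{s=1}^{t-2}\Big(\sum_{k=1}^K\frac{\|\hat V_{k,s+1/2}\|_*^2}{K^2}+\|X_s-X_{s+1}\|_2^2\Big)\Big)^{-\frac12}.$$ The oracle samples and the roundings of one iteration are mutually independent and independent of the past; the scheme $\mathbb L_t$ may be chosen from the information available before the draws of iteration $t$. Let $\varepsilon_{Q,t}$ be the variance bound of $\mathbb L_t$, assumed integrable, let $\overline{\varepsilon_Q}=\mathbb E\big[\frac1T\sum_{t=1}^T\varepsilon_{Q,t}\big]$ be the average variance bound (the expectation is redundant for deterministic schemes), and let $\overline X_{T}=\frac1T\sum_{t=1}^TX_{t+1/2}$. **Theorem.** Let $\mathcal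 X\subset\mathbb R^d$ be a compact neighbourhood of a solution $x^\star$, $D\ge0$ with $D^2=\sup_{p\in\mathcal X}\|X_1-p\|_2^2$, and $\mathrm{Gap}_{\mathcal X}(x)=\sup_{p\in\mathcal X}\langle A(p),x-p\rangle$. Then $$\mathbb E\big[\mathrm{Gap}_{\mathcal X}(\overline X_{T})\big]=\mathcal O\!\left(\frac{(\sigma_R\overline{\varepsilon_Q}+\overline{\varepsilon_Q}+\sigma_R)D^4}{T}\right),$$ in the following sense. Given $d$, $K$, $\|\cdot\|$, $L$, $J$, $\hat q$ and numbers $\sigma_{\max}$, $\delta>0$, $0<D_{\min}\le D_{\max}$, there is a constant $C$ such that for all $A$, all oracles, all $X_1$, $x^\star$, $\mathcal X$, $M$, $q$, all (possibly adaptive) choices of the quantization schemes and all $T\ge 1$ for which $\sigma_R\le\sigma_{\max}$, $D_{\min}\le D\le D_{\max}$ and $\sigma_R\overline{\varepsilon_Q}+\overline{\varepsilon_Q}+\sigma_R\ge\delta$, the gap is integrable and $$\mathbb E\big[\mathrm{Gap}_{\mathcal X}(\overline X_{T})\big]\le C\,\frac{(\sigma_R\overline{\varepsilon_Q}+\overline{\varepsilon_Q}+\sigma_R)D^4}{T}.$$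 In particular, for a fixed problem with $\sigma_R>0$ the bound holds for all $T\ge1$ with one constant (take $\delta=\sigma_R$), whatever the levels are. -/

import Mathlib

open MeasureTheory ProbabilityTheory Topology
open scoped BigOperators

noncomputable section

namespace QODA

/-- The space `ℝ^d` with its Euclidean norm and inner product. -/
abbrev Vec (d : ℕ) : Type := EuclideanSpace ℝ (Fin d)

/-! ### Norms, variational inequalities and the gap function -/

/-- The dual norm `‖v‖_* = sup {⟨v, x⟩ : ‖x‖ ≤ 1}` of a norm `N` on `ℝ^d`. -/
def dualNorm {d : ℕ} (N : Seminorm ℝ (Vec d)) (v : Vec d) : ℝ :=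
  sSup {r : ℝ | ∃ x : Vec d, N x ≤ 1 ∧ r = inner ℝ v x}

/-- `⟨A x - A y, x - y⟩ ≥ 0` for all `x`, `y`. -/
def MonotoneOperator {d : ℕ} (A : Vec d → Vec d) : Prop :=
  ∀ x y : Vec d, 0 ≤ inner ℝ (A x - A y) (x - y)

/-- `‖A x - A y‖_* ≤ L ‖x - y‖` for all `x`, `y`. -/
def LipschitzOperator {d : ℕ} (N : Seminorm ℝ (Vec d)) (A : Vec d → Vec d) (L : ℝ) : Prop :=
  ∀ x y : Vec d, dualNorm N (A x - A y) ≤ L * N (x - y)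

/-- `z` solves the variational inequality `⟨A z, x - z⟩ ≥ 0` for all `x ∈ ℝ^d`. -/
def SolvesVI {d : ℕ} (A : Vec d → Vec d) (z : Vec d) : Prop :=
  ∀ x : Vec d, 0 ≤ inner ℝ (A z) (x - z)

/-- The restricted gap `sup_{p ∈ 𝒳} ⟨A p, x - p⟩`. -/
def gap {d : ℕ} (A : Vec d → Vec d) (𝒳 : Set (Vec d)) (x : Vec d) : ℝ :=
  sSup ((fun p : Vec d => inner ℝ (A p) (x - p)) '' 𝒳)

/-! ### The stochastic oracle -/

/-- Relative noise: for every `x`, the oracle is unbiased and the noise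
`U(x; s) = g(x; s) - A x` satisfies `𝔼 ‖U(x; s)‖_*² ≤ σR ‖A x‖_*²`. -/
structure RelativeNoise {d : ℕ} {S : Type*} [MeasurableSpace S] (N : Seminorm ℝ (Vec d))
    (A : Vec d → Vec d) (g : Vec d → S → Vec d) (ν : Measure S) (σR : ℝ) : Prop where
  integrable : ∀ x, Integrable (g x) ν
  unbiased : ∀ x, ∫ s, g x s ∂ν = A x
  integrable_sq : ∀ x, Integrable (fun s => dualNorm N (g x s - A x) ^ 2) ν
  noise_le : ∀ x, ∫ s, dualNorm N (g x s - A x) ^ 2 ∂ν ≤ σR * dualNorm N (A x) ^ 2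

/-- Almost sure boundedness: for every `x`, `‖g(x; s)‖_* ≤ J` almost surely. -/
def AlmostSurelyBounded {d : ℕ} {S : Type*} [MeasurableSpace S] (N : Seminorm ℝ (Vec d))
    (g : Vec d → S → Vec d) (ν : Measure S) (J : ℝ) : Prop :=
  ∀ x, ∀ᵐ s ∂ν, dualNorm N (g x s) ≤ J

/-! ### Layer-wise quantization -/

/-- A sequence of quantization levels `0 = ℓ_0 < ℓ_1 < ⋯ < ℓ_α < ℓ_{α+1} = 1`, where
`α = num`; the sequence is continued by the value `1`. -/
structure LevelSeq where
  num : ℕ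
  val : ℕ → ℝ
  val_zero : val 0 = 0
  val_lt : ∀ j ≤ num, val j < val (j + 1)
  val_one : ∀ j, num < j → val j = 1

namespace LevelSeq

open Classical in
/-- The index `τ(u) ∈ {0, …, α}` with `ℓ_{τ(u)} ≤ u < ℓ_{τ(u)+1}` for `0 ≤ u < 1`; at the
right end point `τ(1) = α`. -/
def τ (ℓ : LevelSeq) (u : ℝ) : ℕ := Nat.findGreatest (fun j => ℓ.val j ≤ u) ℓ.num

/-- The relative distance `ξ(u)` of `u` from the level below it. -/
def ξ (ℓ : LevelSeq) (u : ℝ) : ℝ :=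
  (u - ℓ.val (ℓ.τ u)) / (ℓ.val (ℓ.τ u + 1) - ℓ.val (ℓ.τ u))

open Classical in
/-- Random rounding of `u`. For `θ` uniform on `[0, 1]` the result is `ℓ_{τ(u)+1}` with
probability `ξ(u)` and `ℓ_{τ(u)}` with probability `1 - ξ(u)`. -/
def round (ℓ : LevelSeq) (u θ : ℝ) : ℝ :=
  if θ < ℓ.ξ u then ℓ.val (ℓ.τ u + 1) else ℓ.val (ℓ.τ u)

/-- The largest ratio `ℓ_{j+1} / ℓ_j`, `1 ≤ j ≤ α`, of consecutive positive levels
(and `1` if `α = 0`). All these ratios exceed `1`. -/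
def maxRatio (ℓ : LevelSeq) : ℝ :=
  (Finset.range (ℓ.num + 1)).sup' ⟨0, by simp⟩
    (fun j => if j = 0 then 1 else ℓ.val (j + 1) / ℓ.val j)

end LevelSeq

/-- A layer-wise quantization scheme with `M` types: every coordinate has a type, and every
type has its own sequence of levels. -/
structure Scheme (d M : ℕ) where
  typ : Fin d → Fin M
  lev : Fin M → LevelSeq

/-- The `L^q` norm of a vector. -/
def lqNorm {d : ℕ} (q : ℕ) (v : Vec d) : ℝ := (∑ i, |v i| ^ q) ^ (1 / (q : ℝ))

namespace Scheme

/-- The random quantization `Q(v)`, with coordinates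
`‖v‖_q · sign(v_i) · q_{ℓ^m}(|v_i| / ‖v‖_q)`, where `m` is the type of the coordinate `i` and
`θ i` is the random number that is used to round this coordinate. -/
def quantize {d M : ℕ} (𝕃 : Scheme d M) (q : ℕ) (v : Vec d) (θ : Fin d → ℝ) : Vec d :=
  WithLp.toLp 2 (fun i =>
    lqNorm q v * Real.sign (v i) * (𝕃.lev (𝕃.typ i)).round (|v i| / lqNorm q v) (θ i))

/-- The largest ratio of consecutive positive levels over all types. -/
def maxRatio {d M : ℕ} (𝕃 : Scheme d M) : ℝ := ⨆ m, (𝕃.lev m).maxRatio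

/-- The largest first level `ℓ_1^m` over all types. -/
def maxFirst {d M : ℕ} (𝕃 : Scheme d M) : ℝ := ⨆ m, (𝕃.lev m).val 1

/-- The threshold dimension `d_th = (2 / ℓ̄_1)^{min(2, q)}`. -/
def dTh {d M : ℕ} (𝕃 : Scheme d M) (q : ℕ) : ℝ := (2 / 𝕃.maxFirst) ^ (min 2 q)

open Classical in
/-- The variance bound `ε_Q` of the scheme for `L^q` normalization:
`(ℓ̄ - 1)² / (4 ℓ̄) + (ℓ̄_1 d^{1/min(q,2)} - 1) 𝟙{d ≥ d_th}
  + (ℓ̄_1² / 4) d^{2/min(q,2)} 𝟙{d < d_th}`. -/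
def εQ {d M : ℕ} (𝕃 : Scheme d M) (q : ℕ) : ℝ :=
  (𝕃.maxRatio - 1) ^ 2 / (4 * 𝕃.maxRatio)
    + (if 𝕃.dTh q ≤ (d : ℝ) then
        𝕃.maxFirst * (d : ℝ) ^ (1 / ((min q 2 : ℕ) : ℝ)) - 1
      else
        𝕃.maxFirst ^ 2 / 4 * (d : ℝ) ^ (2 / ((min q 2 : ℕ) : ℝ)))

end Scheme

/-- The average variance bound `ε̄_Q = (1/T) ∑_{t=1}^T ε_{Q,t}` over the first `T` iterations,
where `ε_{Q,t}` is the variance bound of the scheme in force at iteration `t`. The schemes may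
depend on the past of the algorithm, so the expectation is taken; it has no effect if the
schemes are deterministic. -/
def avgεQ {Ω : Type*} [MeasurableSpace Ω] {d M : ℕ} (P : Measure Ω) (q : ℕ)
    (𝕃 : ℕ → Ω → Scheme d M) (T : ℕ) : ℝ :=
  ∫ w, (∑ t ∈ Finset.Icc 1 T, (𝕃 t w).εQ q) / (T : ℝ) ∂P

/-! ### The randomness of the algorithm -/

/-- The random draws of one iteration: for each of the `K` nodes one oracle sample and `d`
random numbers for rounding. -/
abbrev Draw (S : Type*) (K d : ℕ) : Type _ := Fin K → S × (Fin d → ℝ)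

/-- `ℱ t` is the information available after iteration `t`. The draws of one iteration are
mutually independent and independent of everything that happened before; oracle samples have
law `ν`, the rounding numbers are uniform on `[0, 1]`. The quantization scheme of an iteration
is determined by the information available before the draws of this iteration. -/
structure IsRandomness {Ω S : Type*} [mΩ : MeasurableSpace Ω] [MeasurableSpace S] {K d M : ℕ}
    (P : Measure Ω) (ν : Measure S) (ℱ : Filtration ℕ mΩ) (Z : ℕ → Ω → Draw S K d)
    (𝕃 : ℕ → Ω → Scheme d M) : Prop where
  draw_adapted : ∀ t, Measurable[ℱ (t + 1)] (Z (t + 1))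
  draw_law : ∀ t, P.map (Z (t + 1)) =
    Measure.pi (fun _ : Fin K =>
      ν.prod (Measure.pi (fun _ : Fin d => (volume : Measure ℝ).restrict (Set.Icc 0 1))))
  draw_indep : ∀ t, Indep (MeasurableSpace.comap (Z (t + 1)) inferInstance) (ℱ t) P
  typ_predictable : ∀ t i, Measurable[ℱ t] (fun w => (𝕃 (t + 1) w).typ i)
  num_predictable : ∀ t m, Measurable[ℱ t] (fun w => ((𝕃 (t + 1) w).lev m).num)
  val_predictable : ∀ t m j, Measurable[ℱ t] (fun w => ((𝕃 (t + 1) w).lev m).val j)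

/-! ### The algorithm

Along one realization, `X t` is the iterate `X_t`, `Xh t` is the extrapolated iterate
`X_{t+1/2}`, `Y t` is the dual iterate `Y_t`, and `V t k` is the quantized stochastic dual
vector `V̂_{k,t+1/2}` of node `k`. -/

/-- `γ_t = (1 + ∑_{s=1}^{t-2} ∑_k ‖V̂_{k,s+1/2}‖_*² / K²)^{q̂ - 1/2}`. -/
def γAlt {d K : ℕ} (N : Seminorm ℝ (Vec d)) (qh : ℝ) (V : ℕ → Fin K → Vec d) (t : ℕ) : ℝ :=
  (1 + ∑ s ∈ Finset.Icc 1 (t - 2), ∑ k, dualNorm N (V s k) ^ 2 / (K : ℝ) ^ 2) ^ (qh - 1 / 2)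

/-- `η_t = (1 + ∑_{s=1}^{t-2} (∑_k ‖V̂_{k,s+1/2}‖_*² / K² + ‖X_s - X_{s+1}‖_2²))^{-1/2}`. -/
def ηAlt {d K : ℕ} (N : Seminorm ℝ (Vec d)) (V : ℕ → Fin K → Vec d) (X : ℕ → Vec d)
    (t : ℕ) : ℝ :=
  (1 + ∑ s ∈ Finset.Icc 1 (t - 2),
    ((∑ k, dualNorm N (V s k) ^ 2 / (K : ℝ) ^ 2) + ‖X s - X (s + 1)‖ ^ 2)) ^ (-(1 / 2) : ℝ)

/-- The average `(1/K) ∑_k v_k` over the nodes. -/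
def nodeAvg {d K : ℕ} (v : Fin K → Vec d) : Vec d := (1 / (K : ℝ)) • ∑ k, v k

/-- One realization of quantized optimistic dual averaging with the alternative learning rates,
initial point `X₁`, oracle `g`, quantization schemes `𝕃 t` and draws `z t`. These equations
determine `X t`, `Y t`, `Xh t`, `V t` for all `t ≥ 1` recursively. -/
structure IsRun {S : Type*} {d K M : ℕ} (N : Seminorm ℝ (Vec d)) (qh : ℝ) (q : ℕ)
    (g : Vec d → S → Vec d) (X₁ : Vec d) (𝕃 : ℕ → Scheme d M) (z : ℕ → Draw S K d)
    (X Y Xh : ℕ → Vec d) (V : ℕ → Fin K → Vec d) : Prop where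
  X_one : X 1 = X₁
  Y_one : Y 1 = 0
  V_zero : ∀ k, V 0 k = 0
  extrapolate : ∀ t ≥ 1, Xh t = X t - γAlt N qh V t • nodeAvg (V (t - 1))
  query : ∀ t ≥ 1, ∀ k, V t k = (𝕃 t).quantize q (g (Xh t) (z t k).1) (z t k).2
  dual_step : ∀ t ≥ 1, Y (t + 1) = Y t - nodeAvg (V t)
  primal_step : ∀ t ≥ 1, X (t + 1) = X₁ + ηAlt N V X (t + 1) • Y (t + 1)

/-- The averaged iterate `(1/T) ∑_{t=1}^T X_{t+1/2}`. -/
def avgIterate {d : ℕ} (Xh : ℕ → Vec d) (T : ℕ) : Vec d :=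
  (1 / (T : ℝ)) • ∑ t ∈ Finset.Icc 1 T, Xh t

end QODA

end

set_option linter.unusedSectionVars false

noncomputable section

namespace QODA

/-! ### Equivalence of norms on `ℝ^d` and the dual norm -/

-- What is really proved is a bound `C'/T` in which `C'` depends only on the data fixed in advance.
-- The factor `(σR ε + ε + σR) D⁴`, with `ε` the average variance bound, enters in the last line of
-- the file: it is at least `δ Dmin⁴`, so `C'` may be multiplied by their quotient. The constant
-- does not see the levels, because every rounded value lies in `[0, 1]`; hence `‖Q(v)‖² ≤ d³ ‖v‖²`
-- for every scheme, while `Q(v)` has mean `v`.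
--
-- Let `a_t = A(X_{t+1/2})`, let `v_t` be the averaged quantized feedback and `g_t` its aggregate
-- squared dual norm, and put `G_n = g_1 + ⋯ + g_n`. Relative noise and the bound on `Q` give that
-- `v_t` has conditional mean `a_t` and that the conditional mean of `g_t` is at most `κ' ‖a_t‖²`:
-- the noise dies out with the signal. Moreover `g_t ≤ B` almost surely. The rest uses only these
-- facts (`NoisyRun`).
--
-- Dual averaging and the optimistic step bound the regret along a path by `D²/η` and step-size
-- sums, minus squared movements of the iterates, minus `∑ γ_t ⟨v_t, v_{t-1}⟩`
-- (`OptimisticPath.regret_le`). In expectation the last sum is `∑ γ_t ‖a_{t-1}‖²` up to the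
-- variation `a_t - a_{t-1}` (`integral_correlation_ge`); the delay in `γ` makes both conditionings
-- legitimate. The Lipschitz property turns the variation into movements, already paid for, and
-- step-size sums. All step-size sums are `O(√(1 + G_n))`, so twice the expected regret against one
-- fixed comparator is at most `c E√(1 + G_n) + D⁴ - 2 ∑ E γ_t ‖a_{t-1}‖²`.
--
-- Two facts close the loop. Against a solution of the variational inequality the expected regret is
-- nonnegative, so `∑ E γ_t ‖a_{t-1}‖²` is `O(E√(1 + G_n) + 1)`. Conversely the second moment bound
-- makes `E (1 + G_n)^(q̂ + 1/2)` at most a multiple of that sum plus a constant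
-- (`integral_rpow_le`). As `q̂ > 0`, the higher power absorbs the lower one, and `E√(1 + G_n)` is
-- bounded uniformly in `n` (`exists_integral_sqrt_le`).
--
-- The gap needs a supremum over comparators inside the expectation. The comparator meets the noise
-- only in `⟨∑ (v_t - a_t), X₁ - p⟩`, which is at most `D` times the norm of a martingale, and the
-- mean of that norm is again `O(E√(1 + G_n))` (`integral_norm_noise_le`). Monotonicity of `A`
-- converts regret divided by `T` into the gap of the average.

theorem exists_seminorm_le {d : ℕ} (N : Seminorm ℝ (Vec d)) :
    ∃ C : ℝ, 0 < C ∧ ∀ x, N x ≤ C * ‖x‖ := by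
  refine ⟨1 + ∑ i, N (EuclideanSpace.single i 1), ?_, fun x => ?_⟩
  · have : 0 ≤ ∑ i, N (EuclideanSpace.single i (1 : ℝ)) :=
      Finset.sum_nonneg fun i _ => apply_nonneg N _
    linarith
  · have hx : x = ∑ i, x i • EuclideanSpace.single i (1 : ℝ) := by
      have := (EuclideanSpace.basisFun (Fin d) ℝ).sum_repr x
      simpa using this.symm
    have h1 : N x ≤ ∑ i, N (x i • EuclideanSpace.single i (1 : ℝ)) := by
      conv_lhs => rw [hx]
      exact Finset.le_sum_of_subadditive N (map_zero N).le (map_add_le_add N) _ _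
    have h2 : ∑ i, N (x i • EuclideanSpace.single i (1 : ℝ))
        ≤ ∑ i, N (EuclideanSpace.single i (1 : ℝ)) * ‖x‖ := by
      refine Finset.sum_le_sum fun i _ => ?_
      rw [map_smul_eq_mul, mul_comm]
      exact mul_le_mul_of_nonneg_left (PiLp.norm_apply_le x i) (apply_nonneg N _)
    rw [← Finset.sum_mul] at h2
    nlinarith [norm_nonneg x]

theorem continuous_seminorm {d : ℕ} (N : Seminorm ℝ (Vec d)) : Continuous N := by
  obtain ⟨C, hC, h⟩ := exists_seminorm_le N
  refine (LipschitzWith.of_dist_le_mul (K := ⟨C, hC.le⟩) fun x y => ?_).continuous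
  rw [Real.dist_eq, dist_eq_norm]
  exact (abs_sub_map_le_sub N x y).trans (h _)

theorem exists_norm_le_seminorm {d : ℕ} (N : Seminorm ℝ (Vec d)) (hN : ∀ x, N x = 0 → x = 0) :
    ∃ c : ℝ, 0 < c ∧ ∀ x, ‖x‖ ≤ c * N x := by
  -- The sphere is empty only for `d = 0`; otherwise the constant is the inverse of the minimum of
  -- `N` on it.
  rcases (Metric.sphere (0 : Vec d) 1).eq_empty_or_nonempty with he | hne
  · refine ⟨1, one_pos, fun x => ?_⟩
    by_cases hx : x = 0
    · simp [hx]
    · have : ‖x‖⁻¹ • x ∈ Metric.sphere (0 : Vec d) 1 := by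
        simp [norm_smul, hx]
      rw [he] at this
      exact this.elim
  · obtain ⟨z, hz, hmin⟩ :=
      (isCompact_sphere (0 : Vec d) 1).exists_isMinOn hne (continuous_seminorm N).continuousOn
    have hz1 : ‖z‖ = 1 := by simpa using hz
    have hpos : 0 < N z := by
      refine lt_of_le_of_ne (apply_nonneg N z) fun h => ?_
      rw [hN z h.symm, norm_zero] at hz1
      exact zero_ne_one hz1
    refine ⟨(N z)⁻¹, inv_pos.2 hpos, fun x => ?_⟩
    by_cases hx : x = 0
    · simp [hx]
    · have hx0 : 0 < ‖x‖ := norm_pos_iff.2 hx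
      have hm : N z ≤ N (‖x‖⁻¹ • x) := hmin (by simp [norm_smul, hx])
      rw [map_smul_eq_mul, norm_inv, norm_norm] at hm
      rw [inv_mul_eq_div, le_div_iff₀ hpos]
      calc ‖x‖ * N z ≤ ‖x‖ * (‖x‖⁻¹ * N x) := mul_le_mul_of_nonneg_left hm hx0.le
        _ = N x := by field_simp

theorem dualNorm_le_of_forall {d : ℕ} {N : Seminorm ℝ (Vec d)} {v : Vec d} {b : ℝ}
    (h : ∀ x, N x ≤ 1 → inner ℝ v x ≤ b) : dualNorm N v ≤ b := by
  refine csSup_le ⟨0, 0, by simp, by simp⟩ ?_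
  rintro _ ⟨x, hx, rfl⟩
  exact h x hx

section dual

variable {d : ℕ} {N : Seminorm ℝ (Vec d)} (hN : ∀ x, N x = 0 → x = 0)
include hN

theorem bddAbove_dualNorm_set (v : Vec d) :
    BddAbove {r : ℝ | ∃ x : Vec d, N x ≤ 1 ∧ r = inner ℝ v x} := by
  obtain ⟨c, hc, h⟩ := exists_norm_le_seminorm N hN
  refine ⟨‖v‖ * c, ?_⟩
  rintro _ ⟨x, hx, rfl⟩
  refine (real_inner_le_norm v x).trans (mul_le_mul_of_nonneg_left ?_ (norm_nonneg v))
  exact (h x).trans (mul_le_of_le_one_right hc.le hx)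

theorem inner_le_dualNorm (v : Vec d) {x : Vec d} (hx : N x ≤ 1) :
    inner ℝ v x ≤ dualNorm N v :=
  le_csSup (bddAbove_dualNorm_set hN v) ⟨x, hx, rfl⟩

theorem dualNorm_nonneg (v : Vec d) : 0 ≤ dualNorm N v := by
  have := inner_le_dualNorm hN v (x := 0) (by simp)
  simpa using this

theorem dualNorm_add_le (v w : Vec d) : dualNorm N (v + w) ≤ dualNorm N v + dualNorm N w :=
  dualNorm_le_of_forall fun x hx => by
    rw [inner_add_left]
    exact add_le_add (inner_le_dualNorm hN v hx) (inner_le_dualNorm hN w hx)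

/-- Duality swaps the two equivalence constants: an upper bound of `N` makes `v / (C ‖v‖)` an
admissible test vector, which bounds the dual norm from below, and a lower bound of `N` gives the
upper one by Cauchy–Schwarz. -/
theorem exists_dualNorm_bounds :
    ∃ c C : ℝ, 0 < c ∧ 0 < C ∧ ∀ v, ‖v‖ ≤ c * dualNorm N v ∧ dualNorm N v ≤ C * ‖v‖ := by
  obtain ⟨C, hC, h1⟩ := exists_seminorm_le N
  obtain ⟨c, hc, h2⟩ := exists_norm_le_seminorm N hN
  refine ⟨C, c, hC, hc, fun v => ⟨?_, ?_⟩⟩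
  · by_cases hv : v = 0
    · simpa [hv] using mul_nonneg hC.le (dualNorm_nonneg hN (0 : Vec d))
    · have hv0 : 0 < ‖v‖ := norm_pos_iff.2 hv
      have hx : N ((C * ‖v‖)⁻¹ • v) ≤ 1 := by
        rw [map_smul_eq_mul, Real.norm_of_nonneg (by positivity), inv_mul_le_iff₀ (by positivity)]
        simpa using h1 v
      have := inner_le_dualNorm hN v hx
      rw [inner_smul_right, real_inner_self_eq_norm_sq, inv_mul_le_iff₀ (by positivity)] at this
      nlinarith
  · refine dualNorm_le_of_forall fun x hx => ?_
    refine (real_inner_le_norm v x).trans ?_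
    rw [mul_comm]
    refine mul_le_mul_of_nonneg_right ?_ (norm_nonneg v)
    exact (h2 x).trans (mul_le_of_le_one_right hc.le hx)

theorem continuous_dualNorm : Continuous (dualNorm N) := by
  obtain ⟨c, C, hc, hC, h⟩ := exists_dualNorm_bounds hN
  refine (LipschitzWith.of_le_add_mul ⟨C, hC.le⟩ fun x y => ?_).continuous
  have := dualNorm_add_le hN y (x - y)
  rw [add_sub_cancel] at this
  rw [dist_eq_norm]
  exact this.trans (add_le_add_right (h _).2 _)

end dual

/-! ### Random rounding -/

namespace LevelSeq

theorem val_le_one (ℓ : LevelSeq) (j : ℕ) : ℓ.val j ≤ 1 := by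
  rcases Nat.lt_or_ge ℓ.num j with h | h
  · exact (ℓ.val_one j h).le
  · induction h using Nat.decreasingInduction with
    | self => exact (ℓ.val_lt _ le_rfl).le.trans (ℓ.val_one _ (Nat.lt_succ_self _)).le
    | of_succ k hk ih => exact (ℓ.val_lt k hk.le).le.trans ih

theorem val_nonneg (ℓ : LevelSeq) (j : ℕ) : 0 ≤ ℓ.val j := by
  induction j with
  | zero => exact ℓ.val_zero.ge
  | succ k ih =>
    rcases Nat.lt_or_ge ℓ.num k with h | h
    · rw [ℓ.val_one _ (h.trans (Nat.lt_succ_self k))]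
      exact zero_le_one
    · exact ih.trans (ℓ.val_lt k h).le

theorem round_nonneg (ℓ : LevelSeq) (u θ : ℝ) : 0 ≤ ℓ.round u θ := by
  unfold round
  split_ifs <;> exact ℓ.val_nonneg _

theorem round_le_one (ℓ : LevelSeq) (u θ : ℝ) : ℓ.round u θ ≤ 1 := by
  unfold round
  split_ifs <;> exact ℓ.val_le_one _

theorem τ_le_num (ℓ : LevelSeq) (u : ℝ) : ℓ.τ u ≤ ℓ.num := Nat.findGreatest_le _

theorem val_τ_le (ℓ : LevelSeq) {u : ℝ} (hu : 0 ≤ u) : ℓ.val (ℓ.τ u) ≤ u := by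
  classical
  have : ℓ.val 0 ≤ u := by rw [ℓ.val_zero]; exact hu
  exact Nat.findGreatest_spec (P := fun j => ℓ.val j ≤ u) (Nat.zero_le _) this

theorem le_val_τ_succ (ℓ : LevelSeq) {u : ℝ} (hu : u ≤ 1) : u ≤ ℓ.val (ℓ.τ u + 1) := by
  classical
  rcases (ℓ.τ_le_num u).lt_or_eq with h | h
  · exact (not_le.1 (Nat.findGreatest_is_greatest (P := fun j => ℓ.val j ≤ u)
      (Nat.lt_succ_self (ℓ.τ u)) h)).le
  · rw [h, ℓ.val_one _ (Nat.lt_succ_self _)]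
    exact hu

/-- The uniform distribution on `[0, 1]`. -/
abbrev unif : Measure ℝ := (volume : Measure ℝ).restrict (Set.Icc 0 1)

instance : IsProbabilityMeasure unif := ⟨by simp [unif]⟩

theorem measurable_round_right (ℓ : LevelSeq) (u : ℝ) : Measurable (ℓ.round u) := by
  unfold round
  exact Measurable.ite measurableSet_Iio measurable_const measurable_const

/-- Random rounding is unbiased. -/
theorem integral_round (ℓ : LevelSeq) {u : ℝ} (hu : 0 ≤ u) (hu' : u ≤ 1) :
    ∫ θ, ℓ.round u θ ∂unif = u := by
  have h1 := ℓ.val_τ_le hu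
  have h2 := ℓ.le_val_τ_succ hu'
  have h3 := ℓ.val_lt _ (ℓ.τ_le_num u)
  have hξ0 : 0 ≤ ℓ.ξ u := div_nonneg (by linarith) (by linarith)
  have hξ1 : ℓ.ξ u ≤ 1 := div_le_one_of_le₀ (by linarith) (by linarith)
  have he : ∀ θ, ℓ.round u θ = ℓ.val (ℓ.τ u) + (Set.Iio (ℓ.ξ u)).indicator
      (fun _ => ℓ.val (ℓ.τ u + 1) - ℓ.val (ℓ.τ u)) θ := by
    intro θ
    unfold round
    by_cases h : θ < ℓ.ξ u
    · simp [h]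
    · simp [h]
  have hs : Set.Iio (ℓ.ξ u) ∩ Set.Icc (0 : ℝ) 1 = Set.Ico 0 (ℓ.ξ u) := by
    ext x
    simp only [Set.mem_inter_iff, Set.mem_Iio, Set.mem_Icc, Set.mem_Ico]
    constructor
    · rintro ⟨a, b, c⟩; exact ⟨b, a⟩
    · rintro ⟨a, b⟩; exact ⟨b, a, by linarith⟩
  simp_rw [he]
  rw [integral_add (integrable_const _)
    ((integrable_const _).indicator measurableSet_Iio), integral_indicator measurableSet_Iio]
  simp only [integral_const, MeasurableSet.univ, measureReal_restrict_apply, Set.univ_inter,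
    measurableSet_Iio, Measure.restrict_restrict, hs]
  simp only [Real.volume_real_Icc, Real.volume_real_Ico, smul_eq_mul, sub_zero]
  rw [max_eq_left zero_le_one, max_eq_left hξ0, one_mul, ξ, div_mul_cancel₀ _ (by linarith)]
  ring

end LevelSeq

/-! ### Quantization of a fixed vector -/

theorem lqNorm_nonneg {d : ℕ} (q : ℕ) (v : Vec d) : 0 ≤ lqNorm q v :=
  Real.rpow_nonneg (Finset.sum_nonneg fun _ _ => by positivity) _

theorem abs_le_lqNorm {d : ℕ} {q : ℕ} (hq : 1 ≤ q) (v : Vec d) (i : Fin d) :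
    |v i| ≤ lqNorm q v := by
  have hq0 : (q : ℝ) ≠ 0 := by positivity
  have h : |v i| ^ q ≤ ∑ j, |v j| ^ q :=
    Finset.single_le_sum (f := fun j => |v j| ^ q) (fun _ _ => by positivity) (Finset.mem_univ i)
  have := Real.rpow_le_rpow (by positivity) h (z := 1 / (q : ℝ)) (by positivity)
  rwa [← Real.rpow_natCast, ← Real.rpow_mul (abs_nonneg _), mul_one_div_cancel hq0,
    Real.rpow_one] at this

/-- The `ℓ^q` norm is at most the `ℓ^1` norm, so the constant can be chosen independently of `q`. -/
theorem lqNorm_le {d : ℕ} {q : ℕ} (hq : 1 ≤ q) (v : Vec d) : lqNorm q v ≤ d * ‖v‖ := by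
  have hq0 : (q : ℝ) ≠ 0 := by positivity
  have hS : ∑ i, |v i| ≤ d * ‖v‖ := by
    have := Finset.sum_le_card_nsmul Finset.univ (fun i => |v i|) ‖v‖
      fun i _ => PiLp.norm_apply_le v i
    simpa using this
  have hS0 : 0 ≤ ∑ i, |v i| := Finset.sum_nonneg fun _ _ => abs_nonneg _
  have h : ∑ j, |v j| ^ q ≤ (∑ i, |v i|) ^ q := by
    obtain ⟨n, rfl⟩ := Nat.exists_eq_succ_of_ne_zero (Nat.one_le_iff_ne_zero.1 hq)
    rw [pow_succ, Finset.mul_sum]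
    refine Finset.sum_le_sum fun i _ => ?_
    rw [pow_succ]
    refine mul_le_mul_of_nonneg_right (pow_le_pow_left₀ (abs_nonneg _) ?_ n) (abs_nonneg _)
    exact Finset.single_le_sum (f := fun j => |v j|) (fun _ _ => abs_nonneg _) (Finset.mem_univ i)
  have := Real.rpow_le_rpow (Finset.sum_nonneg fun _ _ => by positivity) h
    (z := 1 / (q : ℝ)) (by positivity)
  rw [← Real.rpow_natCast, ← Real.rpow_mul hS0, mul_one_div_cancel hq0, Real.rpow_one] at this
  exact this.trans hS

namespace Scheme

/-- Rounded values lie in `[0, 1]` and signs in `[-1, 1]`, so only `‖v‖_q` remains. This crude bound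
is uniform over all schemes and is what makes the final constant independent of the levels. -/
theorem abs_quantize_le {d M : ℕ} (𝕃 : Scheme d M) {q : ℕ} (hq : 1 ≤ q) (v : Vec d)
    (θ : Fin d → ℝ) (i : Fin d) : |𝕃.quantize q v θ i| ≤ d * ‖v‖ := by
  have h1 : |(v i).sign| ≤ 1 := by
    rcases Real.sign_apply_eq (v i) with h | h | h <;> simp [h]
  have h2 := LevelSeq.round_nonneg (𝕃.lev (𝕃.typ i)) (|v i| / lqNorm q v) (θ i)
  have h3 := LevelSeq.round_le_one (𝕃.lev (𝕃.typ i)) (|v i| / lqNorm q v) (θ i)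
  have h0 := lqNorm_nonneg q v
  refine le_trans ?_ (lqNorm_le hq v)
  simp only [quantize, abs_mul, abs_of_nonneg h0, abs_of_nonneg h2]
  calc _ ≤ lqNorm q v * 1 * 1 := by gcongr
    _ = _ := by ring

theorem norm_sq_quantize_le {d M : ℕ} (𝕃 : Scheme d M) {q : ℕ} (hq : 1 ≤ q) (v : Vec d)
    (θ : Fin d → ℝ) : ‖𝕃.quantize q v θ‖ ^ 2 ≤ (d : ℝ) ^ 3 * ‖v‖ ^ 2 := by
  rw [EuclideanSpace.norm_sq_eq]
  have := Finset.sum_le_card_nsmul Finset.univ (fun i => ‖𝕃.quantize q v θ i‖ ^ 2)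
    ((d * ‖v‖) ^ 2) fun i _ => by
      rw [Real.norm_eq_abs]
      exact pow_le_pow_left₀ (abs_nonneg _) (𝕃.abs_quantize_le hq v θ i) 2
  refine this.trans (le_of_eq ?_)
  rw [Finset.card_univ, Fintype.card_fin, nsmul_eq_mul]
  ring

/-- Random quantization is unbiased in every coordinate. -/
theorem integral_quantize_apply {d M : ℕ} (𝕃 : Scheme d M) {q : ℕ} (hq : 1 ≤ q) (v : Vec d)
    (i : Fin d) :
    ∫ θ, 𝕃.quantize q v θ i ∂(Measure.pi fun _ : Fin d => LevelSeq.unif) = v i := by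
  have h0 := lqNorm_nonneg q v
  have hi := abs_le_lqNorm hq v i
  have hm := measurePreserving_eval (fun _ : Fin d => LevelSeq.unif) i
  have hint : ∫ θ : Fin d → ℝ, (𝕃.lev (𝕃.typ i)).round (|v i| / lqNorm q v) (θ i)
      ∂(Measure.pi fun _ : Fin d => LevelSeq.unif) = |v i| / lqNorm q v := by
    refine Eq.trans ?_ (LevelSeq.integral_round (𝕃.lev (𝕃.typ i))
      (div_nonneg (abs_nonneg (v i)) h0) (div_le_one_of_le₀ hi h0))
    have := integral_map (μ := Measure.pi fun _ : Fin d => LevelSeq.unif)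
      hm.measurable.aemeasurable (f := (𝕃.lev (𝕃.typ i)).round (|v i| / lqNorm q v))
      (LevelSeq.measurable_round_right _ _).aestronglyMeasurable
    rw [hm.map_eq] at this
    exact this.symm
  simp only [quantize]
  rw [integral_const_mul, hint]
  -- If `‖v‖_q = 0`, the normalized coordinate is a division by zero, but then `v i = 0` and both
  -- sides vanish.
  rcases h0.eq_or_lt with h | h
  · have : v i = 0 := abs_eq_zero.1 (le_antisymm (hi.trans h.ge) (abs_nonneg _))
    simp [this]
  · rw [mul_assoc, mul_div_assoc', mul_div_assoc', mul_div_cancel_left₀ _ h.ne']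
    rcases lt_trichotomy (v i) 0 with h' | h' | h'
    · rw [Real.sign_of_neg h', abs_of_neg h']; ring
    · simp [h']
    · rw [Real.sign_of_pos h', abs_of_pos h', one_mul]

end Scheme

section

/-! ### Sums of adaptive step sizes -/

theorem sum_Icc_pred (f : ℕ → ℝ) (n : ℕ) :
    ∑ t ∈ Finset.Icc 1 n, f (t - 1) + f n = ∑ t ∈ Finset.Icc 1 n, f t + f 0 := by
  induction n with
  | zero => simp
  | succ n ih =>
    rw [Finset.sum_Icc_succ_top (by omega), Finset.sum_Icc_succ_top (by omega)]
    simp only [Nat.add_sub_cancel]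
    linarith

theorem sum_Icc_pred_le {f : ℕ → ℝ} (hf : ∀ t, 0 ≤ f t) (h0 : f 0 = 0) (n : ℕ) :
    ∑ t ∈ Finset.Icc 1 n, f (t - 1) ≤ ∑ t ∈ Finset.Icc 1 n, f t := by
  have := sum_Icc_pred f n
  have := hf n
  linarith

/-- The partial sum `g_1 + ⋯ + g_n`. -/
def psum (g : ℕ → ℝ) (n : ℕ) : ℝ := ∑ s ∈ Finset.Icc 1 n, g s

theorem psum_zero (g : ℕ → ℝ) : psum g 0 = 0 := by simp [psum]

theorem psum_succ (g : ℕ → ℝ) (n : ℕ) : psum g (n + 1) = psum g n + g (n + 1) := by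
  unfold psum
  rw [Finset.sum_Icc_succ_top (by omega)]

theorem psum_nonneg {g : ℕ → ℝ} (hg : ∀ s, 0 ≤ g s) (n : ℕ) : 0 ≤ psum g n :=
  Finset.sum_nonneg fun s _ => hg s

theorem psum_mono {g : ℕ → ℝ} (hg : ∀ s, 0 ≤ g s) : Monotone (psum g) :=
  monotone_nat_of_le_succ fun n => by
    rw [psum_succ]
    linarith [hg (n + 1)]

theorem psum_le_pred_add {g : ℕ → ℝ} {B : ℝ} (hB : ∀ s, g s ≤ B) (hB0 : 0 ≤ B) (n : ℕ) :
    psum g n ≤ psum g (n - 1) + B := by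
  rcases n with _ | n
  · simpa using hB0
  · rw [psum_succ, Nat.add_sub_cancel]
    linarith [hB (n + 1)]

theorem div_sqrt_le_sqrt_sub {a b : ℝ} (ha : 0 < a) (hab : a ≤ b) :
    (b - a) / √b ≤ 2 * (√b - √a) := by
  have hb : 0 < b := ha.trans_le hab
  have hsb : 0 < √b := Real.sqrt_pos.2 hb
  rw [div_le_iff₀ hsb]
  nlinarith [Real.sq_sqrt ha.le, Real.sq_sqrt hb.le, sq_nonneg (√b - √a)]

/-- Without delay the sum telescopes, since `(b - a)/√b ≤ 2(√b - √a)`. A delay by two indices omits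
at most `2B` from the denominator, which costs the factor `√(1 + 2B)`. -/
theorem sum_div_sqrt_le {g : ℕ → ℝ} {B : ℝ} (hg : ∀ s, 0 ≤ g s) (hB : ∀ s, g s ≤ B) (n : ℕ) :
    ∑ t ∈ Finset.Icc 1 n, g t / √(1 + psum g (t - 2)) ≤
      2 * √(1 + 2 * B) * √(1 + psum g n) := by
  have hB0 : 0 ≤ B := (hg 0).trans (hB 0)
  have key : ∀ t, 1 ≤ t → g t / √(1 + psum g (t - 2)) ≤
      √(1 + 2 * B) * (2 * (√(1 + psum g t) - √(1 + psum g (t - 1)))) := by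
    intro t ht
    obtain ⟨m, rfl⟩ := Nat.exists_eq_add_of_le' ht
    have h0 := psum_nonneg hg (m + 1 - 2)
    have h1 := psum_nonneg hg m
    have h2 : psum g (m + 1) ≤ psum g (m + 1 - 2) + 2 * B := by
      have := psum_le_pred_add hB hB0 (m + 1)
      have := psum_le_pred_add hB hB0 (m + 1 - 1)
      rw [Nat.sub_sub] at this
      linarith
    have h3 := psum_succ g m
    have h4 := div_sqrt_le_sqrt_sub (a := 1 + psum g m) (b := 1 + psum g (m + 1)) (by linarith)
      (by linarith [hg (m + 1)])
    -- Uses `1 + G + 2B ≤ (1 + 2B)(1 + G)` for `G ≥ 0`.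
    have h5 : √(1 + psum g (m + 1)) ≤ √(1 + 2 * B) * √(1 + psum g (m + 1 - 2)) := by
      rw [← Real.sqrt_mul (by linarith)]
      exact Real.sqrt_le_sqrt (by nlinarith)
    have hs1 : 0 < √(1 + psum g (m + 1 - 2)) := Real.sqrt_pos.2 (by linarith)
    have hs2 : 0 < √(1 + psum g (m + 1)) := Real.sqrt_pos.2 (by linarith [hg (m + 1)])
    calc g (m + 1) / √(1 + psum g (m + 1 - 2))
        ≤ √(1 + 2 * B) * (g (m + 1) / √(1 + psum g (m + 1))) := by
          rw [mul_div_assoc', div_le_div_iff₀ hs1 hs2]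
          nlinarith [hg (m + 1)]
      _ ≤ _ := by
          refine mul_le_mul_of_nonneg_left ?_ (Real.sqrt_nonneg _)
          rw [Nat.add_sub_cancel]
          refine le_trans (le_of_eq ?_) h4
          congr 1
          linarith
  have htel : ∀ n, ∑ t ∈ Finset.Icc 1 n, (√(1 + psum g t) - √(1 + psum g (t - 1)))
      = √(1 + psum g n) - 1 := by
    intro n
    have := sum_Icc_pred (fun t => √(1 + psum g t)) n
    rw [psum_zero, add_zero, Real.sqrt_one] at this
    rw [Finset.sum_sub_distrib]
    linarith
  calc _ ≤ ∑ t ∈ Finset.Icc 1 n,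
        √(1 + 2 * B) * (2 * (√(1 + psum g t) - √(1 + psum g (t - 1)))) :=
        Finset.sum_le_sum fun t ht => key t (Finset.mem_Icc.1 ht).1
    _ = √(1 + 2 * B) * (2 * (√(1 + psum g n) - 1)) := by
        rw [← Finset.mul_sum, ← Finset.mul_sum, htel]
    _ ≤ _ := by nlinarith [Real.sqrt_nonneg (1 + 2 * B)]

/-- Since `y^{1/2} = o(y^{q + 1/2})`, a multiple of the former is absorbed by the latter. -/
theorem exists_mul_sqrt_le {q : ℝ} (hq : 0 < q) (C : ℝ) (hC : 0 ≤ C) :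
    ∃ C' : ℝ, ∀ y : ℝ, 1 ≤ y → C * √y ≤ (1 / 2) * y ^ (q + 1 / 2) + C' := by
  refine ⟨C * √((2 * C) ^ (1 / q)), fun y hy => ?_⟩
  have hy0 : 0 < y := by linarith
  have h1 : y ^ (q + 1 / 2) = y ^ q * √y := by rw [Real.rpow_add hy0, Real.sqrt_eq_rpow]
  rw [h1]
  have hs := Real.sqrt_nonneg y
  -- Above the threshold `y^q = 2C` the power wins outright; below it `y` is bounded, and the bound
  -- goes into `C'`.
  rcases le_total (2 * C) (y ^ q) with h | h
  · have : 0 ≤ C * √((2 * C) ^ (1 / q)) := by positivity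
    nlinarith
  · have hle : y ≤ (2 * C) ^ (1 / q) := by
      have := Real.rpow_le_rpow (by positivity) h (z := 1 / q) (by positivity)
      rwa [← Real.rpow_mul hy0.le, mul_one_div_cancel hq.ne', Real.rpow_one] at this
    have := mul_le_mul_of_nonneg_left (Real.sqrt_le_sqrt hle) hC
    have : 0 ≤ y ^ q * √y := by positivity
    linarith

/-! ### Optimistic dual averaging along one realization -/

variable {E : Type*} [NormedAddCommGroup E] [InnerProductSpace ℝ E]

/-- One realization of optimistic dual averaging with feedback vectors `v t` of size `g t` and
mean vectors `a t`, and with two adaptive learning rates `γ` (extrapolation) and `η` (update). -/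
structure OptimisticPath (qh κ L : ℝ) (X Y Xh v a : ℕ → E) (g γ η : ℕ → ℝ) : Prop where
  Y_one : Y 1 = 0
  v_zero : v 0 = 0
  a_zero : a 0 = 0
  g_zero : g 0 = 0
  extrapolate : ∀ t ≥ 1, Xh t = X t - γ t • v (t - 1)
  dual_step : ∀ t ≥ 1, Y (t + 1) = Y t - v t
  primal_step : ∀ t ≥ 1, X (t + 1) = X 1 + η (t + 1) • Y (t + 1)
  γ_eq : ∀ t, γ t = (1 + psum g (t - 2)) ^ (qh - 1 / 2)
  η_eq : ∀ t, η t = (√(1 + psum (fun s => g s + ‖X s - X (s + 1)‖ ^ 2) (t - 2)))⁻¹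
  g_nonneg : ∀ t, 0 ≤ g t
  v_le : ∀ t, ‖v t‖ ^ 2 ≤ κ * g t
  a_lip : ∀ s ≥ 1, ∀ t ≥ 1, ‖a t - a s‖ ≤ L * ‖Xh t - Xh s‖

namespace OptimisticPath

variable {qh κ L : ℝ} {X Y Xh v a : ℕ → E} {g γ η : ℕ → ℝ}

theorem psum_step_nonneg (h : OptimisticPath qh κ L X Y Xh v a g γ η) (n : ℕ) :
    0 ≤ psum (fun s => g s + ‖X s - X (s + 1)‖ ^ 2) n :=
  psum_nonneg (fun s => add_nonneg (h.g_nonneg s) (by positivity)) n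

theorem η_pos (h : OptimisticPath qh κ L X Y Xh v a g γ η) (t : ℕ) : 0 < η t := by
  rw [h.η_eq]
  exact inv_pos.2 (Real.sqrt_pos.2 (by linarith [h.psum_step_nonneg (t - 2)]))

theorem η_antitone (h : OptimisticPath qh κ L X Y Xh v a g γ η) : Antitone η := by
  intro s t hst
  rw [h.η_eq, h.η_eq]
  refine inv_anti₀ (Real.sqrt_pos.2 (by linarith [h.psum_step_nonneg (s - 2)]))
    (Real.sqrt_le_sqrt ?_)
  have := psum_mono (g := fun s => g s + ‖X s - X (s + 1)‖ ^ 2)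
    (fun s => add_nonneg (h.g_nonneg s) (by positivity)) (Nat.sub_le_sub_right hst 2)
  linarith

theorem η_le_one (h : OptimisticPath qh κ L X Y Xh v a g γ η) (t : ℕ) : η t ≤ 1 := by
  rw [h.η_eq]
  refine inv_le_one_of_one_le₀ (Real.one_le_sqrt.2 ?_)
  linarith [h.psum_step_nonneg (t - 2)]

theorem η_le (h : OptimisticPath qh κ L X Y Xh v a g γ η) (t : ℕ) :
    η t ≤ (√(1 + psum g (t - 2)))⁻¹ := by
  rw [h.η_eq]
  refine inv_anti₀ (Real.sqrt_pos.2 (by linarith [psum_nonneg h.g_nonneg (t - 2)]))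
    (Real.sqrt_le_sqrt ?_)
  have : psum g (t - 2) ≤ psum (fun s => g s + ‖X s - X (s + 1)‖ ^ 2) (t - 2) :=
    Finset.sum_le_sum fun s _ => le_add_of_nonneg_right (by positivity)
  linarith

theorem γ_nonneg (h : OptimisticPath qh κ L X Y Xh v a g γ η) (t : ℕ) : 0 ≤ γ t := by
  rw [h.γ_eq]
  exact Real.rpow_nonneg (by linarith [psum_nonneg h.g_nonneg (t - 2)]) _

theorem γ_le_one (h : OptimisticPath qh κ L X Y Xh v a g γ η) (hq : qh ≤ 1 / 4) (t : ℕ) :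
    γ t ≤ 1 := by
  rw [h.γ_eq]
  exact Real.rpow_le_one_of_one_le_of_nonpos (by linarith [psum_nonneg h.g_nonneg (t - 2)])
    (by linarith)

/-- The condition `q̂ ≤ 1/4` is what gives `2q̂ - 1 ≤ -1/2`, so that `γ²` is summable against the
feedback at the same rate as `η`. The index `t + 1` is the one with which `v t` is extrapolated. -/
theorem γ_sq_le (h : OptimisticPath qh κ L X Y Xh v a g γ η) (hq : qh ≤ 1 / 4) (t : ℕ) :
    γ (t + 1) ^ 2 ≤ (√(1 + psum g (t - 2)))⁻¹ := by
  have h0 := psum_nonneg h.g_nonneg (t - 2)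
  have h1 := psum_nonneg h.g_nonneg (t + 1 - 2)
  have hm := psum_mono h.g_nonneg (show t - 2 ≤ t + 1 - 2 by omega)
  rw [h.γ_eq, ← Real.rpow_natCast, ← Real.rpow_mul (by linarith), Real.sqrt_eq_rpow,
    ← Real.rpow_neg (by linarith)]
  refine (Real.rpow_le_rpow_of_exponent_le (by linarith)
    (show (qh - 1 / 2) * ((2 : ℕ) : ℝ) ≤ -(1 / 2) by push_cast; linarith)).trans ?_
  exact Real.rpow_le_rpow_of_nonpos (by linarith) (by linarith) (by norm_num)

theorem sub_start (h : OptimisticPath qh κ L X Y Xh v a g γ η) {t : ℕ} (ht : 1 ≤ t) :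
    X t = X 1 + η t • Y t := by
  obtain ⟨m, rfl⟩ := Nat.exists_eq_add_of_le' ht
  rcases m with _ | m
  · simp [h.Y_one]
  · exact h.primal_step _ (by omega)

theorem dual_eq (h : OptimisticPath qh κ L X Y Xh v a g γ η) (n : ℕ) :
    Y (n + 1) = -∑ t ∈ Finset.Icc 1 n, v t := by
  induction n with
  | zero => simp [h.Y_one]
  | succ n ih =>
    rw [h.dual_step _ (by omega), ih, Finset.sum_Icc_succ_top (by omega)]
    abel

/-- The energy inequality of dual averaging with a decreasing learning rate. -/
theorem energy (h : OptimisticPath qh κ L X Y Xh v a g γ η) (n : ℕ) :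
    ∑ t ∈ Finset.Icc 1 n,
        (2 * inner ℝ (v t) (X (t + 1) - X 1) + ‖X t - X (t + 1)‖ ^ 2 / η t) ≤
      -(η (n + 1) * ‖Y (n + 1)‖ ^ 2) := by
  induction n with
  | zero => simp [h.Y_one]
  | succ n ih =>
    rw [Finset.sum_Icc_succ_top (by omega)]
    have hη := h.η_pos (n + 1)
    have hη' := h.η_pos (n + 1 + 1)
    have hle := h.η_antitone (Nat.le_succ (n + 1))
    have hv : v (n + 1) = Y (n + 1) - Y (n + 1 + 1) := by
      rw [h.dual_step (n + 1) (by omega)]; abel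
    have hX : X (n + 1) - X (n + 1 + 1) =
        η (n + 1) • Y (n + 1) - η (n + 1 + 1) • Y (n + 1 + 1) := by
      rw [h.sub_start (t := n + 1) (by omega), h.sub_start (t := n + 1 + 1) (by omega)]; abel
    have hX1 : X (n + 1 + 1) - X 1 = η (n + 1 + 1) • Y (n + 1 + 1) := by
      rw [h.sub_start (t := n + 1 + 1) (by omega)]; abel
    rw [hX, hX1, hv, norm_sub_sq_real, norm_smul, norm_smul, inner_smul_right, inner_smul_right,
      inner_smul_left, inner_sub_left, real_inner_self_eq_norm_sq, Real.norm_of_nonneg hη.le,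
      Real.norm_of_nonneg hη'.le]
    simp only [conj_trivial, Nat.succ_eq_add_one] at *
    set e := η (n + 1)
    set e' := η (n + 1 + 1)
    set y := ‖Y (n + 1)‖
    set y' := ‖Y (n + 1 + 1)‖
    set i : ℝ := inner ℝ (Y (n + 1)) (Y (n + 1 + 1))
    -- The mixed term `i` cancels against the one in `2⟨v, X_{t+1} - X_1⟩`; what is left telescopes
    -- up to the factor `e' / e ≤ 1`.
    have hdiv : ((e * y) ^ 2 - 2 * (e' * (e * i)) + (e' * y') ^ 2) / e =
        e * y ^ 2 - 2 * (e' * i) + e' * y' ^ 2 * (e' / e) := by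
      field_simp
    have hr : e' / e ≤ 1 := div_le_one_of_le₀ hle hη.le
    have hp : 0 ≤ e' * y' ^ 2 := by positivity
    rw [hdiv]
    nlinarith

/-- For the iterate that already knows `v t`, the comparator enters only through `⟨Y_{n+1}, X_1 -
p⟩`, because the feedback sums to `-Y_{n+1}`. Young's inequality with weight `η` pays for this term
with the negative `η ‖Y_{n+1}‖²` of `energy`. -/
theorem regret_lookahead (h : OptimisticPath qh κ L X Y Xh v a g γ η) (n : ℕ) (p : E) :
    2 * ∑ t ∈ Finset.Icc 1 n, inner ℝ (v t) (X (t + 1) - p) ≤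
      ‖X 1 - p‖ ^ 2 / η (n + 1) - ∑ t ∈ Finset.Icc 1 n, ‖X t - X (t + 1)‖ ^ 2 / η t := by
  have he := h.energy n
  have hη := h.η_pos (n + 1)
  have hs : ∑ t ∈ Finset.Icc 1 n, inner ℝ (v t) (X (t + 1) - p) =
      ∑ t ∈ Finset.Icc 1 n, inner ℝ (v t) (X (t + 1) - X 1) - inner ℝ (Y (n + 1)) (X 1 - p) := by
    rw [h.dual_eq, inner_neg_left, sum_inner, sub_neg_eq_add, ← Finset.sum_add_distrib]
    refine Finset.sum_congr rfl fun t _ => ?_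
    rw [← inner_add_right]
    congr 1
    abel
  rw [Finset.sum_add_distrib, ← Finset.mul_sum] at he
  have hi : -inner ℝ (Y (n + 1)) (X 1 - p) ≤ ‖Y (n + 1)‖ * ‖X 1 - p‖ := by
    rw [← inner_neg_left, ← norm_neg (Y (n + 1))]
    exact real_inner_le_norm _ _
  have hyoung : 2 * (‖Y (n + 1)‖ * ‖X 1 - p‖) ≤
      η (n + 1) * ‖Y (n + 1)‖ ^ 2 + ‖X 1 - p‖ ^ 2 / η (n + 1) := by
    have h2 : η (n + 1) * ‖Y (n + 1)‖ ^ 2 + ‖X 1 - p‖ ^ 2 / η (n + 1) =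
        ((η (n + 1) * ‖Y (n + 1)‖) ^ 2 + ‖X 1 - p‖ ^ 2) / η (n + 1) := by
      field_simp
    rw [h2, le_div_iff₀ hη]
    nlinarith [sq_nonneg (η (n + 1) * ‖Y (n + 1)‖ - ‖X 1 - p‖)]
  rw [hs]
  linarith

/-- The part of the regret bound that does not involve the correlation of consecutive feedback
vectors. -/
def regretBound (D : ℝ) (X v : ℕ → E) (η : ℕ → ℝ) (n : ℕ) : ℝ :=
  D ^ 2 / η (n + 1) - (1 / 2) * ∑ t ∈ Finset.Icc 1 n, ‖X t - X (t + 1)‖ ^ 2 / η t +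
    2 * ∑ t ∈ Finset.Icc 1 n, η t * ‖v t‖ ^ 2

/-- The played point differs from the lookahead point by `X t - X (t + 1)` and the extrapolation.
The former costs half of the negative movement terms by Young's inequality; the latter produces
exactly the correlation of consecutive feedback vectors. -/
theorem regret_le (h : OptimisticPath qh κ L X Y Xh v a g γ η) (n : ℕ) {p : E} {D : ℝ}
    (hp : ‖X 1 - p‖ ^ 2 ≤ D ^ 2) :
    2 * ∑ t ∈ Finset.Icc 1 n, inner ℝ (v t) (Xh t - p) ≤
      regretBound D X v η n - 2 * ∑ t ∈ Finset.Icc 1 n, γ t * inner ℝ (v t) (v (t - 1)) := by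
  have h1 := h.regret_lookahead n p
  have h2 : ‖X 1 - p‖ ^ 2 / η (n + 1) ≤ D ^ 2 / η (n + 1) :=
    div_le_div_of_nonneg_right hp (h.η_pos _).le
  have h3 : ∑ t ∈ Finset.Icc 1 n, 2 * inner ℝ (v t) (Xh t - p) ≤
      ∑ t ∈ Finset.Icc 1 n, (2 * inner ℝ (v t) (X (t + 1) - p) +
        (1 / 2) * (‖X t - X (t + 1)‖ ^ 2 / η t) + 2 * (η t * ‖v t‖ ^ 2) -
        2 * (γ t * inner ℝ (v t) (v (t - 1)))) := by
    refine Finset.sum_le_sum fun t ht => ?_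
    have hη := h.η_pos t
    have hd : Xh t - p = (X (t + 1) - p) + (X t - X (t + 1)) - γ t • v (t - 1) := by
      rw [h.extrapolate t (Finset.mem_Icc.1 ht).1]; abel
    rw [hd, inner_sub_right, inner_add_right, inner_smul_right]
    have hcs := real_inner_le_norm (v t) (X t - X (t + 1))
    have hyoung : 2 * (‖v t‖ * ‖X t - X (t + 1)‖) ≤
        (1 / 2) * (‖X t - X (t + 1)‖ ^ 2 / η t) + 2 * (η t * ‖v t‖ ^ 2) := by
      have h2 : (1 / 2) * (‖X t - X (t + 1)‖ ^ 2 / η t) + 2 * (η t * ‖v t‖ ^ 2) =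
          ((1 / 2) * ‖X t - X (t + 1)‖ ^ 2 + 2 * (η t * ‖v t‖) ^ 2) / η t := by
        field_simp
      rw [h2, le_div_iff₀ hη]
      nlinarith [sq_nonneg (2 * (η t * ‖v t‖) - ‖X t - X (t + 1)‖)]
    linarith
  rw [← Finset.mul_sum, Finset.sum_sub_distrib, Finset.sum_add_distrib, Finset.sum_add_distrib,
    ← Finset.mul_sum, ← Finset.mul_sum, ← Finset.mul_sum, ← Finset.mul_sum] at h3
  unfold regretBound
  linarith

/-- The constant of the pathwise bound `regretBound_add_le`. -/
def pathConst (κ L B D : ℝ) : ℝ := D ^ 2 + (2 + 4 * L ^ 2 + 4 * L) * (κ * (2 * √(1 + 2 * B)))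

theorem pathConst_nonneg {κ L B D : ℝ} (hκ : 0 ≤ κ) (hL : 0 ≤ L) : 0 ≤ pathConst κ L B D := by
  unfold pathConst
  positivity

/-- Consecutive played points differ by one movement of `X` and two extrapolations, so the Lipschitz
bound reduces the variation of `a` to terms that are already controlled. -/
theorem variation_term_le (h : OptimisticPath qh κ L X Y Xh v a g γ η) (hL : 0 ≤ L) {s : ℕ}
    (hs : 1 ≤ s) :
    2 * (γ (s + 1) * (‖a (s + 1) - a s‖ * ‖v s‖)) ≤
      (1 / 4) * ‖X s - X (s + 1)‖ ^ 2 + (4 * L ^ 2 + 3 * L) * (γ (s + 1) ^ 2 * ‖v s‖ ^ 2) +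
        L * (γ s ^ 2 * ‖v (s - 1)‖ ^ 2) := by
  have hγ := h.γ_nonneg (s + 1)
  have hγ' := h.γ_nonneg s
  have hd : ‖Xh (s + 1) - Xh s‖ ≤
      ‖X s - X (s + 1)‖ + γ (s + 1) * ‖v s‖ + γ s * ‖v (s - 1)‖ := by
    have he : Xh (s + 1) - Xh s =
        -(X s - X (s + 1)) - γ (s + 1) • v s + γ s • v (s - 1) := by
      rw [h.extrapolate s hs, h.extrapolate (s + 1) (by omega), Nat.add_sub_cancel]; abel
    rw [he]
    refine (norm_add_le _ _).trans ((add_le_add_left (norm_sub_le _ _) _).trans (le_of_eq ?_))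
    rw [norm_neg, norm_smul, norm_smul, Real.norm_of_nonneg hγ, Real.norm_of_nonneg hγ']
  have ha := h.a_lip s hs (s + 1) (by omega)
  have h1 : γ (s + 1) * (‖a (s + 1) - a s‖ * ‖v s‖) ≤
      γ (s + 1) * ((L * (‖X s - X (s + 1)‖ + γ (s + 1) * ‖v s‖ + γ s * ‖v (s - 1)‖)) * ‖v s‖) := by
    gcongr
    exact ha.trans (by gcongr)
  set x := ‖X s - X (s + 1)‖
  set u := γ (s + 1) * ‖v s‖ with hu
  set u' := γ s * ‖v (s - 1)‖ with hu'
  rw [← mul_pow, ← mul_pow, ← hu, ← hu']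
  have h2 : γ (s + 1) * ((L * (x + u + u')) * ‖v s‖) = L * (x + u + u') * u := by rw [hu]; ring
  have h3 : 0 ≤ L * (u - u') ^ 2 := by positivity
  -- This square splits `2 L x u` into `x²/4 + 4 L² u²`, and `L (u - u')²` splits `2 L u u'`.
  nlinarith [sq_nonneg (x - 4 * (L * u))]

/-- Half of the total squared movement is available with a negative sign, since `η ≤ 1`. One quarter
pays for the variation of `a`, the other for the movements hidden in `1 / η (n + 1)`; only sums of
order `√(1 + G_n)` survive. -/
theorem regretBound_add_le (h : OptimisticPath qh κ L X Y Xh v a g γ η) (hq : qh ≤ 1 / 4)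
    (hκ : 0 ≤ κ) (hL : 0 ≤ L) {B : ℝ} (hB : ∀ t, g t ≤ B) (D : ℝ) (n : ℕ) :
    regretBound D X v η n +
        2 * ∑ t ∈ Finset.Icc 1 n, γ t * (‖a t - a (t - 1)‖ * ‖v (t - 1)‖) ≤
      pathConst κ L B D * √(1 + psum g n) + D ^ 4 := by
  have hsum := sum_div_sqrt_le h.g_nonneg hB n
  set W := √(1 + psum g n) with hW
  have hpos : ∀ t, 0 < √(1 + psum g (t - 2)) := fun t =>
    Real.sqrt_pos.2 (by linarith [psum_nonneg h.g_nonneg (t - 2)])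
  -- the sums that are controlled by the step sizes
  have hS : ∀ c : ℕ → ℝ, (∀ t, c t ≤ (√(1 + psum g (t - 2)))⁻¹) →
      ∑ t ∈ Finset.Icc 1 n, c t * ‖v t‖ ^ 2 ≤ κ * (2 * √(1 + 2 * B)) * W := by
    intro c hc
    calc _ ≤ ∑ t ∈ Finset.Icc 1 n, κ * (g t / √(1 + psum g (t - 2))) := by
          refine Finset.sum_le_sum fun t _ => ?_
          calc c t * ‖v t‖ ^ 2 ≤ (√(1 + psum g (t - 2)))⁻¹ * (κ * g t) :=
                mul_le_mul (hc t) (h.v_le t) (by positivity) (inv_pos.2 (hpos t)).le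
            _ = _ := by rw [div_eq_mul_inv]; ring
      _ ≤ _ := by
          rw [← Finset.mul_sum, mul_assoc]
          exact mul_le_mul_of_nonneg_left hsum hκ
  have hη := hS η h.η_le
  have hγ := hS (fun t => γ (t + 1) ^ 2) (h.γ_sq_le hq)
  set S := κ * (2 * √(1 + 2 * B)) * W
  -- the variation of the mean vectors
  let c : ℕ → ℝ := fun s => γ (s + 1) ^ 2 * ‖v s‖ ^ 2
  have hc0 : c 0 = 0 := by simp [c, h.v_zero]
  have hc : ∀ s, 0 ≤ c s := fun s => by positivity
  -- The delayed sum reaches the index `0`, where `X 0` is arbitrary; the movement there is set to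
  -- `0`, which is harmless because `v 0 = 0`.
  let x : ℕ → ℝ := fun s => if s = 0 then 0 else ‖X s - X (s + 1)‖ ^ 2
  have hx0 : ∀ s, 0 ≤ x s := fun s => by dsimp only [x]; split_ifs <;> positivity
  let f : ℕ → ℝ := fun s => (1 / 4) * x s + (4 * L ^ 2 + 3 * L) * c s + L * c (s - 1)
  have hf0 : ∀ s, 0 ≤ f s := fun s => by
    have := hx0 s; have := hc s; have := hc (s - 1); positivity
  have hvar : 2 * ∑ t ∈ Finset.Icc 1 n, γ t * (‖a t - a (t - 1)‖ * ‖v (t - 1)‖) ≤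
      ∑ t ∈ Finset.Icc 1 n, f t := by
    rw [Finset.mul_sum]
    refine le_trans (Finset.sum_le_sum fun t ht => ?_)
      (sum_Icc_pred_le hf0 (by simp [f, x, hc0]) n)
    obtain ⟨s, rfl⟩ := Nat.exists_eq_add_of_le' (Finset.mem_Icc.1 ht).1
    rw [Nat.add_sub_cancel]
    rcases Nat.eq_zero_or_pos s with rfl | hs
    · simpa [h.v_zero] using hf0 0
    · refine (h.variation_term_le hL hs).trans (le_of_eq ?_)
      simp only [f, x, c, hs.ne', if_false, Nat.sub_add_cancel hs]
  have hf : ∑ t ∈ Finset.Icc 1 n, f t ≤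
      (1 / 4) * ∑ t ∈ Finset.Icc 1 n, x t + (4 * L ^ 2 + 4 * L) * S := by
    simp only [f]
    rw [Finset.sum_add_distrib, Finset.sum_add_distrib, ← Finset.mul_sum, ← Finset.mul_sum,
      ← Finset.mul_sum]
    have h1 := sum_Icc_pred_le hc hc0 n
    have h2 : (4 * L ^ 2 + 3 * L) * ∑ t ∈ Finset.Icc 1 n, c t ≤ (4 * L ^ 2 + 3 * L) * S :=
      mul_le_mul_of_nonneg_left hγ (by positivity)
    have h3 := mul_le_mul_of_nonneg_left (h1.trans hγ) hL
    linarith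
  -- the movement of the iterates
  have hxsum : ∑ t ∈ Finset.Icc 1 n, x t = psum (fun s => ‖X s - X (s + 1)‖ ^ 2) n :=
    Finset.sum_congr rfl fun t ht => by
      have := (Finset.mem_Icc.1 ht).1
      simp [x, show t ≠ 0 by omega]
  set Sx := psum (fun s => ‖X s - X (s + 1)‖ ^ 2) n with hSx
  have hSx0 : 0 ≤ Sx := psum_nonneg (fun s => by positivity) n
  have hmove : Sx ≤ ∑ t ∈ Finset.Icc 1 n, ‖X t - X (t + 1)‖ ^ 2 / η t := by
    refine Finset.sum_le_sum fun t _ => ?_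
    rw [le_div_iff₀ (h.η_pos t)]
    exact mul_le_of_le_one_right (by positivity) (h.η_le_one t)
  -- The summand `D⁴` arises here, from `D² √Sx ≤ Sx/4 + D⁴`.
  have hinv : D ^ 2 / η (n + 1) ≤ D ^ 2 * W + ((1 / 4) * Sx + D ^ 4) := by
    have h1 : 1 / η (n + 1) ≤ W + √Sx := by
      rw [h.η_eq, one_div, inv_inv]
      have h2 : psum (fun s => g s + ‖X s - X (s + 1)‖ ^ 2) (n + 1 - 2) ≤ psum g n + Sx := by
        refine (psum_mono (fun s => add_nonneg (h.g_nonneg s) (by positivity))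
          (show n + 1 - 2 ≤ n by omega)).trans (le_of_eq ?_)
        exact Finset.sum_add_distrib
      have hg0 := psum_nonneg h.g_nonneg n
      refine Real.sqrt_le_iff.2 ⟨by positivity, ?_⟩
      nlinarith [Real.sq_sqrt hSx0, Real.sq_sqrt (show 0 ≤ 1 + psum g n by linarith),
        mul_nonneg (Real.sqrt_nonneg (1 + psum g n)) (Real.sqrt_nonneg Sx)]
    have h3 : D ^ 2 / η (n + 1) ≤ D ^ 2 * (W + √Sx) := by
      rw [div_eq_mul_one_div]
      exact mul_le_mul_of_nonneg_left h1 (sq_nonneg D)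
    nlinarith [Real.sq_sqrt hSx0, sq_nonneg ((1 / 2) * √Sx - D ^ 2)]
  unfold regretBound pathConst
  rw [hxsum] at hf
  have e1 : (D ^ 2 + (2 + 4 * L ^ 2 + 4 * L) * (κ * (2 * √(1 + 2 * B)))) * W =
    D ^ 2 * W + (2 + 4 * L ^ 2 + 4 * L) * S := by ring
  rw [e1]
  linarith

/-- The value `w` of the rate at the full sum is below every `γ t` used so far, so `∑ γ_t g_{t-1}`
dominates `w` times the sum of the `g_{t-1}`. The last term `g n` is not reached by the delayed sum
and is bounded by `B`. -/
theorem rpow_le_sum (h : OptimisticPath qh κ L X Y Xh v a g γ η) (hq : qh ≤ 1 / 4) {B : ℝ}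
    (hB : ∀ t, g t ≤ B) (n : ℕ) :
    (1 + psum g n) ^ (qh + 1 / 2) ≤ ∑ t ∈ Finset.Icc 1 n, γ t * g (t - 1) + (1 + B) := by
  have h0 := psum_nonneg h.g_nonneg n
  have hB0 : 0 ≤ B := (h.g_nonneg 0).trans (hB 0)
  set w := (1 + psum g n) ^ (qh - 1 / 2) with hw
  have hw0 : 0 ≤ w := Real.rpow_nonneg (by linarith) _
  have hw1 : w ≤ 1 := Real.rpow_le_one_of_one_le_of_nonpos (by linarith) (by linarith)
  have h1 : (1 + psum g n) ^ (qh + 1 / 2) = w * (1 + psum g n) := by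
    rw [show qh + 1 / 2 = qh - 1 / 2 + 1 by ring, Real.rpow_add_one (by linarith)]
  have h2 : w * ∑ t ∈ Finset.Icc 1 n, g (t - 1) ≤ ∑ t ∈ Finset.Icc 1 n, γ t * g (t - 1) := by
    rw [Finset.mul_sum]
    refine Finset.sum_le_sum fun t ht => mul_le_mul_of_nonneg_right ?_ (h.g_nonneg _)
    rw [h.γ_eq]
    have := psum_nonneg h.g_nonneg (t - 2)
    have hm := psum_mono h.g_nonneg (show t - 2 ≤ n by have := (Finset.mem_Icc.1 ht).2; omega)
    exact Real.rpow_le_rpow_of_nonpos (by linarith) (by linarith) (by linarith)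
  have h3 := sum_Icc_pred g n
  rw [h.g_zero, add_zero] at h3
  have h4 : psum g n = ∑ t ∈ Finset.Icc 1 n, g (t - 1) + g n := h3.symm
  rw [h1]
  have h5 : w * (1 + g n) ≤ 1 * (1 + B) :=
    mul_le_mul hw1 (by linarith [hB n]) (by linarith [h.g_nonneg n]) zero_le_one
  nlinarith

end OptimisticPath

end

section

/-! ### Essentially bounded random variables -/

section EssBdd

variable {Ω : Type*} {mΩ : MeasurableSpace Ω} {P : Measure Ω}
  {E : Type*} [NormedAddCommGroup E]

/-- Measurable and almost surely bounded by a constant. -/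
def EssBdd (P : Measure Ω) (f : Ω → E) : Prop :=
  AEStronglyMeasurable f P ∧ ∃ C : ℝ, ∀ᵐ w ∂P, ‖f w‖ ≤ C

namespace EssBdd

/-- This class is closed under the operations used below and serves only to guarantee integrability;
the bounds may grow with time and are not tracked. -/
theorem integrable [IsFiniteMeasure P] {f : Ω → E} (hf : EssBdd P f) : Integrable f P := by
  obtain ⟨hm, C, hC⟩ := hf
  exact Integrable.of_bound hm C hC

theorem const (c : E) : EssBdd P (fun _ => c) :=
  ⟨aestronglyMeasurable_const, ‖c‖, ae_of_all _ fun _ => le_rfl⟩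

theorem add {f g : Ω → E} (hf : EssBdd P f) (hg : EssBdd P g) :
    EssBdd P (fun w => f w + g w) := by
  obtain ⟨hm, C, hC⟩ := hf
  obtain ⟨hm', C', hC'⟩ := hg
  refine ⟨hm.add hm', C + C', ?_⟩
  filter_upwards [hC, hC'] with w h h'
  exact (norm_add_le _ _).trans (add_le_add h h')

theorem neg {f : Ω → E} (hf : EssBdd P f) : EssBdd P (fun w => -f w) := by
  obtain ⟨hm, C, hC⟩ := hf
  refine ⟨hm.neg, C, ?_⟩
  filter_upwards [hC] with w h
  rwa [norm_neg]

theorem sub {f g : Ω → E} (hf : EssBdd P f) (hg : EssBdd P g) :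
    EssBdd P (fun w => f w - g w) := by
  simpa [sub_eq_add_neg] using hf.add hg.neg

theorem norm {f : Ω → E} (hf : EssBdd P f) : EssBdd P (fun w => ‖f w‖) := by
  obtain ⟨hm, C, hC⟩ := hf
  refine ⟨hm.norm, C, ?_⟩
  filter_upwards [hC] with w h
  rwa [norm_norm]

theorem smul [NormedSpace ℝ E] {r : Ω → ℝ} {f : Ω → E} (hr : EssBdd P r) (hf : EssBdd P f) :
    EssBdd P (fun w => r w • f w) := by
  obtain ⟨hm, C, hC⟩ := hr
  obtain ⟨hm', C', hC'⟩ := hf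
  refine ⟨hm.smul hm', C * C', ?_⟩
  filter_upwards [hC, hC'] with w h h'
  rw [norm_smul]
  exact mul_le_mul h h' (norm_nonneg _) ((norm_nonneg _).trans h)

theorem mul {r f : Ω → ℝ} (hr : EssBdd P r) (hf : EssBdd P f) : EssBdd P (fun w => r w * f w) :=
  hr.smul hf

theorem sq {f : Ω → ℝ} (hf : EssBdd P f) : EssBdd P (fun w => f w ^ 2) := by
  simpa [pow_two] using hf.mul hf

theorem inner [InnerProductSpace ℝ E] {f g : Ω → E} (hf : EssBdd P f) (hg : EssBdd P g) :
    EssBdd P (fun w => inner ℝ (f w) (g w)) := by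
  obtain ⟨hm, C, hC⟩ := hf
  obtain ⟨hm', C', hC'⟩ := hg
  refine ⟨hm.inner hm', C * C', ?_⟩
  filter_upwards [hC, hC'] with w h h'
  exact (norm_inner_le_norm _ _).trans
    (mul_le_mul h h' (norm_nonneg _) ((norm_nonneg _).trans h))

theorem sum {ι : Type*} (s : Finset ι) {f : ι → Ω → E} (hf : ∀ i ∈ s, EssBdd P (f i)) :
    EssBdd P (fun w => ∑ i ∈ s, f i w) := by
  classical
  induction s using Finset.induction_on with
  | empty => simpa using const (P := P) (0 : E)
  | insert i s hi ih =>
    simp_rw [Finset.sum_insert hi]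
    exact (hf i (Finset.mem_insert_self i s)).add
      (ih fun j hj => hf j (Finset.mem_insert_of_mem hj))

theorem of_mem_Icc {f : Ω → ℝ} (hm : Measurable f) {b : ℝ} (h0 : ∀ w, 0 ≤ f w)
    (hb : ∀ᵐ w ∂P, f w ≤ b) : EssBdd P f :=
  ⟨hm.aestronglyMeasurable, b, by
    filter_upwards [hb] with w h
    rwa [Real.norm_of_nonneg (h0 w)]⟩

end EssBdd

end EssBdd

/-! ### Optimistic dual averaging with relative noise -/

variable {Ω : Type*} {mΩ : MeasurableSpace Ω} {P : Measure Ω}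
  {E : Type*} [NormedAddCommGroup E] [InnerProductSpace ℝ E] [MeasurableSpace E] [BorelSpace E]
  [SecondCountableTopology E]

/-- Optimistic dual averaging with unbiased feedback whose conditional second moment is
proportional to the squared norm of its conditional mean. -/
structure NoisyRun (P : Measure Ω) (ℱ : Filtration ℕ mΩ) (qh κ κ' L B : ℝ) (X₁ : E)
    (X Y Xh v a : ℕ → Ω → E) (g γ η : ℕ → Ω → ℝ) : Prop where
  path : ∀ w, OptimisticPath qh κ L (fun t => X t w) (fun t => Y t w) (fun t => Xh t w)
    (fun t => v t w) (fun t => a t w) (fun t => g t w) (fun t => γ t w) (fun t => η t w)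
  X_one : ∀ w, X 1 w = X₁
  v_meas : ∀ t, Measurable[ℱ t] (v t)
  g_meas : ∀ t, Measurable[ℱ t] (g t)
  X_meas : ∀ t ≥ 1, Measurable[ℱ (t - 1)] (X t)
  a_meas : ∀ t, Measurable[ℱ (t - 1)] (a t)
  g_le : ∀ᵐ w ∂P, ∀ t, g t w ≤ B
  a_bdd : ∃ C : ℝ, ∀ t w, ‖a t w‖ ≤ C
  mean : ∀ t ≥ 1, ∀ h : Ω → E, Measurable[ℱ (t - 1)] h → EssBdd P h →
    ∫ w, inner ℝ (h w) (v t w) ∂P = ∫ w, inner ℝ (h w) (a t w) ∂P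
  second_moment : ∀ t ≥ 1, ∀ h : Ω → ℝ, Measurable[ℱ (t - 1)] h → (∀ w, 0 ≤ h w) →
    (∀ w, h w ≤ 1) → ∫ w, h w * g t w ∂P ≤ κ' * ∫ w, h w * ‖a t w‖ ^ 2 ∂P

namespace NoisyRun

variable {ℱ : Filtration ℕ mΩ} {qh κ κ' L B : ℝ} {X₁ : E}
  {X Y Xh v a : ℕ → Ω → E} {g γ η : ℕ → Ω → ℝ}

-- Measurability of the processes of a noisy run

section measurability

theorem psum_meas {f : ℕ → Ω → ℝ} {n m : ℕ} (hf : ∀ s, 1 ≤ s → s ≤ n → Measurable[ℱ m] (f s)) :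
    Measurable[ℱ m] (fun w => psum (fun s => f s w) n) := by
  unfold psum
  exact Finset.measurable_fun_sum _ fun s hs =>
    hf s (Finset.mem_Icc.1 hs).1 (Finset.mem_Icc.1 hs).2

theorem psum_g_meas (h : NoisyRun P ℱ qh κ κ' L B X₁ X Y Xh v a g γ η) {n m : ℕ} (hn : n ≤ m) :
    Measurable[ℱ m] (fun w => psum (fun s => g s w) n) :=
  psum_meas fun s _ hs => (h.g_meas s).mono (ℱ.mono (hs.trans hn)) le_rfl

/-- The index `t - 2`, rather than `t - 1`, is decisive: it allows conditioning on the past of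
iteration `t - 1` with `γ t` as a factor. -/
theorem γ_meas (h : NoisyRun P ℱ qh κ κ' L B X₁ X Y Xh v a g γ η) (t : ℕ) :
    Measurable[ℱ (t - 2)] (γ t) := by
  have : γ t = fun w => (1 + psum (fun s => g s w) (t - 2)) ^ (qh - 1 / 2) :=
    funext fun w => (h.path w).γ_eq t
  rw [this]
  exact (measurable_const.add (h.psum_g_meas le_rfl)).pow_const _

theorem Xh_meas (h : NoisyRun P ℱ qh κ κ' L B X₁ X Y Xh v a g γ η) {t : ℕ} (ht : 1 ≤ t) :
    Measurable[ℱ (t - 1)] (Xh t) := by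
  have : Xh t = fun w => X t w - γ t w • v (t - 1) w :=
    funext fun w => (h.path w).extrapolate t ht
  rw [this]
  exact (h.X_meas t ht).sub
    (((h.γ_meas t).mono (ℱ.mono (by omega)) le_rfl).smul (h.v_meas (t - 1)))

theorem η_meas (h : NoisyRun P ℱ qh κ κ' L B X₁ X Y Xh v a g γ η) (t : ℕ) : Measurable (η t) := by
  have : η t = fun w =>
      (√(1 + psum (fun s => g s w + ‖X s w - X (s + 1) w‖ ^ 2) (t - 2)))⁻¹ :=
    funext fun w => (h.path w).η_eq t
  rw [this]
  have hm : Measurable[ℱ t] (fun w =>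
      psum (fun s => g s w + ‖X s w - X (s + 1) w‖ ^ 2) (t - 2)) := by
    refine psum_meas (f := fun s w => g s w + ‖X s w - X (s + 1) w‖ ^ 2) fun s hs hs' => ?_
    have hd : Measurable[ℱ t] (fun w => X s w - X (s + 1) w) :=
      ((h.X_meas s hs).mono (ℱ.mono (by omega)) le_rfl).sub
        ((h.X_meas (s + 1) (by omega)).mono (ℱ.mono (by omega)) le_rfl)
    exact ((h.g_meas s).mono (ℱ.mono (by omega)) le_rfl).add
      ((measurable_norm.comp hd).pow_const 2)
  exact (((measurable_const.add hm).sqrt).inv).mono (ℱ.le t) le_rfl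

/-- The inverse of the square root of the delayed cumulative size of the feedback. -/
def weight (g : ℕ → Ω → ℝ) (t : ℕ) (w : Ω) : ℝ := (√(1 + psum (fun s => g s w) (t - 2)))⁻¹

theorem weight_meas (h : NoisyRun P ℱ qh κ κ' L B X₁ X Y Xh v a g γ η) (t : ℕ) :
    Measurable[ℱ (t - 1)] (weight g t) :=
  ((measurable_const.add (h.psum_g_meas (by omega))).sqrt).inv

end measurability

theorem weight_pos (h : NoisyRun P ℱ qh κ κ' L B X₁ X Y Xh v a g γ η) (t : ℕ) (w : Ω) :
    0 < weight g t w :=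
  inv_pos.2 (Real.sqrt_pos.2 (by linarith [psum_nonneg (h.path w).g_nonneg (t - 2)]))

theorem weight_le_one (h : NoisyRun P ℱ qh κ κ' L B X₁ X Y Xh v a g γ η) (t : ℕ) (w : Ω) :
    weight g t w ≤ 1 :=
  inv_le_one_of_one_le₀ (Real.one_le_sqrt.2 (by linarith [psum_nonneg (h.path w).g_nonneg (t - 2)]))

theorem weight_antitone (h : NoisyRun P ℱ qh κ κ' L B X₁ X Y Xh v a g γ η) (w : Ω) :
    Antitone (fun t => weight g t w) := by
  intro s t hst
  refine inv_anti₀ (Real.sqrt_pos.2 (by linarith [psum_nonneg (h.path w).g_nonneg (s - 2)]))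
    (Real.sqrt_le_sqrt ?_)
  linarith [psum_mono (h.path w).g_nonneg (Nat.sub_le_sub_right hst 2)]

-- Essential boundedness of the processes of a noisy run

section boundedness

theorem bdd_g (h : NoisyRun P ℱ qh κ κ' L B X₁ X Y Xh v a g γ η) (t : ℕ) : EssBdd P (g t) :=
  .of_mem_Icc ((h.g_meas t).mono (ℱ.le t) le_rfl) (fun w => (h.path w).g_nonneg t)
    (h.g_le.mono fun _ hw => hw t)

theorem bdd_v (h : NoisyRun P ℱ qh κ κ' L B X₁ X Y Xh v a g γ η) (hκ : 0 ≤ κ) (t : ℕ) :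
    EssBdd P (v t) := by
  refine ⟨((h.v_meas t).mono (ℱ.le t) le_rfl).aestronglyMeasurable, √(κ * B), ?_⟩
  filter_upwards [h.g_le] with w hw
  exact Real.le_sqrt_of_sq_le (((h.path w).v_le t).trans (mul_le_mul_of_nonneg_left (hw t) hκ))

theorem bdd_a (h : NoisyRun P ℱ qh κ κ' L B X₁ X Y Xh v a g γ η) (t : ℕ) : EssBdd P (a t) := by
  obtain ⟨C, hC⟩ := h.a_bdd
  exact ⟨((h.a_meas t).mono (ℱ.le _) le_rfl).aestronglyMeasurable, C, ae_of_all _ (hC t)⟩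

theorem bdd_γ (h : NoisyRun P ℱ qh κ κ' L B X₁ X Y Xh v a g γ η) (hq : qh ≤ 1 / 4) (t : ℕ) :
    EssBdd P (γ t) :=
  .of_mem_Icc ((h.γ_meas t).mono (ℱ.le _) le_rfl) (fun w => (h.path w).γ_nonneg t)
    (ae_of_all _ fun w => (h.path w).γ_le_one hq t)

theorem bdd_η (h : NoisyRun P ℱ qh κ κ' L B X₁ X Y Xh v a g γ η) (t : ℕ) : EssBdd P (η t) :=
  .of_mem_Icc (h.η_meas t) (fun w => ((h.path w).η_pos t).le)
    (ae_of_all _ fun w => (h.path w).η_le_one t)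

theorem bdd_weight (h : NoisyRun P ℱ qh κ κ' L B X₁ X Y Xh v a g γ η) (t : ℕ) :
    EssBdd P (weight g t) :=
  .of_mem_Icc ((h.weight_meas t).mono (ℱ.le _) le_rfl) (fun w => (h.weight_pos t w).le)
    (ae_of_all _ fun w => h.weight_le_one t w)

theorem bdd_X (h : NoisyRun P ℱ qh κ κ' L B X₁ X Y Xh v a g γ η) (hκ : 0 ≤ κ) {t : ℕ}
    (ht : 1 ≤ t) : EssBdd P (X t) := by
  obtain ⟨n, rfl⟩ := Nat.exists_eq_add_of_le' ht
  have : X (n + 1) = fun w => X₁ + η (n + 1) w • (-∑ s ∈ Finset.Icc 1 n, v s w) := by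
    funext w
    rw [← (h.path w).dual_eq n, ← h.X_one w]
    exact (h.path w).sub_start ht
  rw [this]
  exact (EssBdd.const X₁).add ((h.bdd_η _).smul (EssBdd.sum _ fun s _ => h.bdd_v hκ s).neg)

theorem bdd_Xh (h : NoisyRun P ℱ qh κ κ' L B X₁ X Y Xh v a g γ η) (hκ : 0 ≤ κ)
    (hq : qh ≤ 1 / 4) {t : ℕ} (ht : 1 ≤ t) : EssBdd P (Xh t) := by
  have : Xh t = fun w => X t w - γ t w • v (t - 1) w :=
    funext fun w => (h.path w).extrapolate t ht
  rw [this]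
  exact (h.bdd_X hκ ht).sub ((h.bdd_γ hq t).smul (h.bdd_v hκ _))

theorem bdd_inv_η (h : NoisyRun P ℱ qh κ κ' L B X₁ X Y Xh v a g γ η) (hκ : 0 ≤ κ) (t : ℕ) :
    EssBdd P (fun w => (η t w)⁻¹) := by
  have hb : EssBdd P (fun w => psum (fun s => g s w + ‖X s w - X (s + 1) w‖ ^ 2) (t - 2)) :=
    EssBdd.sum _ fun s hs => (h.bdd_g s).add
      ((h.bdd_X hκ (Finset.mem_Icc.1 hs).1).sub (h.bdd_X hκ (by omega))).norm.sq
  obtain ⟨-, C, hC⟩ := hb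
  refine EssBdd.of_mem_Icc (b := √(1 + C)) (h.η_meas t).inv
    (fun w => (inv_pos.2 ((h.path w).η_pos t)).le) ?_
  filter_upwards [hC] with w hw
  rw [(h.path w).η_eq, inv_inv]
  exact Real.sqrt_le_sqrt (by linarith [le_of_abs_le hw])

theorem bdd_psum (h : NoisyRun P ℱ qh κ κ' L B X₁ X Y Xh v a g γ η) (n : ℕ) :
    EssBdd P (fun w => psum (fun s => g s w) n) :=
  EssBdd.sum _ fun s _ => h.bdd_g s

theorem bdd_sqrt (h : NoisyRun P ℱ qh κ κ' L B X₁ X Y Xh v a g γ η) (n : ℕ) :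
    EssBdd P (fun w => √(1 + psum (fun s => g s w) n)) := by
  obtain ⟨-, C, hC⟩ := h.bdd_psum n
  refine EssBdd.of_mem_Icc (b := √(1 + C))
    ((measurable_const.add (h.psum_g_meas le_rfl)).sqrt.mono (ℱ.le n) le_rfl)
    (fun w => Real.sqrt_nonneg _) ?_
  filter_upwards [hC] with w hw
  exact Real.sqrt_le_sqrt (by linarith [le_of_abs_le hw])

theorem bdd_rpow (h : NoisyRun P ℱ qh κ κ' L B X₁ X Y Xh v a g γ η) {r : ℝ} (hr : 0 ≤ r)
    (n : ℕ) : EssBdd P (fun w => (1 + psum (fun s => g s w) n) ^ r) := by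
  obtain ⟨-, C, hC⟩ := h.bdd_psum n
  have h0 := fun w => psum_nonneg (h.path w).g_nonneg n
  refine EssBdd.of_mem_Icc (b := (1 + C) ^ r)
    (((measurable_const.add (h.psum_g_meas le_rfl)).pow_const r).mono (ℱ.le n) le_rfl)
    (fun w => Real.rpow_nonneg (by linarith [h0 w]) _) ?_
  filter_upwards [hC] with w hw
  exact Real.rpow_le_rpow (by linarith [h0 w]) (by linarith [le_of_abs_le hw]) hr

theorem bdd_regretBound (h : NoisyRun P ℱ qh κ κ' L B X₁ X Y Xh v a g γ η) (hκ : 0 ≤ κ)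
    (D : ℝ) (n : ℕ) : EssBdd P (fun w => OptimisticPath.regretBound D (fun t => X t w)
      (fun t => v t w) (fun t => η t w) n) := by
  unfold OptimisticPath.regretBound
  simp_rw [div_eq_mul_inv]
  refine (((EssBdd.const _).mul (h.bdd_inv_η hκ _)).sub ((EssBdd.const _).mul
    (EssBdd.sum _ fun t ht => ?_))).add ((EssBdd.const _).mul (EssBdd.sum _ fun t ht => ?_))
  · exact (((h.bdd_X hκ (Finset.mem_Icc.1 ht).1).sub (h.bdd_X hκ (by omega))).norm.sq).mul
      (h.bdd_inv_η hκ t)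
  · exact (h.bdd_η t).mul (h.bdd_v hκ t).norm.sq

end boundedness

-- Regret and feedback size in expectation

variable [IsProbabilityMeasure P]

/-- The correlation of consecutive feedback vectors is, in expectation, the squared norm of the
mean up to the variation of the mean. The delay in the learning rate `γ` is essential here. -/
theorem integral_correlation_ge (h : NoisyRun P ℱ qh κ κ' L B X₁ X Y Xh v a g γ η)
    (hκ : 0 ≤ κ) (hq : qh ≤ 1 / 4) {t : ℕ} (ht : 1 ≤ t) :
    ∫ w, γ t w * ‖a (t - 1) w‖ ^ 2 ∂P -
        ∫ w, γ t w * (‖a t w - a (t - 1) w‖ * ‖v (t - 1) w‖) ∂P ≤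
      ∫ w, γ t w * inner ℝ (v t w) (v (t - 1) w) ∂P := by
  -- Condition twice: given the past of iteration `t`, `v t` becomes `a t`; after replacing `a t` by
  -- `a (t - 1)`, conditioning on the past of iteration `t - 1` turns `v (t - 1)` into `a (t - 1)`.
  have hγ := h.bdd_γ hq t
  have hv := h.bdd_v hκ (t - 1)
  have ha := h.bdd_a t
  have ha' := h.bdd_a (t - 1)
  have e1 : ∫ w, γ t w * inner ℝ (v t w) (v (t - 1) w) ∂P =
      ∫ w, γ t w * inner ℝ (a t w) (v (t - 1) w) ∂P := by
    have := h.mean t ht (fun w => γ t w • v (t - 1) w)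
      (((h.γ_meas t).mono (ℱ.mono (by omega)) le_rfl).smul (h.v_meas (t - 1))) (hγ.smul hv)
    simpa only [inner_smul_left, conj_trivial, real_inner_comm] using this
  have e2 : ∫ w, γ t w * inner ℝ (a (t - 1) w) (v (t - 1) w) ∂P =
      ∫ w, γ t w * ‖a (t - 1) w‖ ^ 2 ∂P := by
    rcases Nat.lt_or_ge t 2 with h2 | h2
    · have h0 : t - 1 = 0 := by omega
      rw [h0]
      have ha0 : ∀ w, a 0 w = 0 := fun w => (h.path w).a_zero
      simp [ha0]
    · have := h.mean (t - 1) (by omega) (fun w => γ t w • a (t - 1) w)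
        (((h.γ_meas t).mono (ℱ.mono (by omega)) le_rfl).smul (h.a_meas (t - 1))) (hγ.smul ha')
      simpa only [inner_smul_left, conj_trivial, real_inner_self_eq_norm_sq] using this
  rw [e1, ← e2, ← integral_sub (hγ.mul (ha'.inner hv)).integrable
    (hγ.mul ((ha.sub ha').norm.mul hv.norm)).integrable]
  refine integral_mono ((hγ.mul (ha'.inner hv)).sub
    (hγ.mul ((ha.sub ha').norm.mul hv.norm))).integrable (hγ.mul (ha.inner hv)).integrable
    fun w => ?_
  have hcs := abs_real_inner_le_norm (a t w - a (t - 1) w) (v (t - 1) w)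
  have hlow := neg_le_of_abs_le hcs
  rw [inner_sub_left] at hlow
  have := mul_le_mul_of_nonneg_left hlow ((h.path w).γ_nonneg t)
  simp only at this ⊢
  linarith

/-- The regret against a fixed comparator is bounded in expectation by the cumulative size of
the feedback minus the weighted squared norms of the means. -/
theorem integral_regretBound_le (h : NoisyRun P ℱ qh κ κ' L B X₁ X Y Xh v a g γ η)
    (hκ : 0 ≤ κ) (hL : 0 ≤ L) (hq : qh ≤ 1 / 4) (D : ℝ) (n : ℕ) :
    ∫ w, (OptimisticPath.regretBound D (fun t => X t w) (fun t => v t w) (fun t => η t w) n -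
        2 * ∑ t ∈ Finset.Icc 1 n, γ t w * inner ℝ (v t w) (v (t - 1) w)) ∂P ≤
      OptimisticPath.pathConst κ L B D * ∫ w, √(1 + psum (fun s => g s w) n) ∂P + D ^ 4 -
        2 * ∑ t ∈ Finset.Icc 1 n, ∫ w, γ t w * ‖a (t - 1) w‖ ^ 2 ∂P := by
  have bR := h.bdd_regretBound hκ D n
  have bc : ∀ t, EssBdd P (fun w => γ t w * inner ℝ (v t w) (v (t - 1) w)) := fun t =>
    (h.bdd_γ hq t).mul ((h.bdd_v hκ t).inner (h.bdd_v hκ (t - 1)))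
  have bd : ∀ t, EssBdd P (fun w => γ t w * (‖a t w - a (t - 1) w‖ * ‖v (t - 1) w‖)) := fun t =>
    (h.bdd_γ hq t).mul (((h.bdd_a t).sub (h.bdd_a (t - 1))).norm.mul (h.bdd_v hκ (t - 1)).norm)
  have bW := h.bdd_sqrt n
  have e1 : ∑ t ∈ Finset.Icc 1 n, (∫ w, γ t w * ‖a (t - 1) w‖ ^ 2 ∂P -
      ∫ w, γ t w * (‖a t w - a (t - 1) w‖ * ‖v (t - 1) w‖) ∂P) ≤
      ∑ t ∈ Finset.Icc 1 n, ∫ w, γ t w * inner ℝ (v t w) (v (t - 1) w) ∂P :=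
    Finset.sum_le_sum fun t ht =>
      h.integral_correlation_ge hκ hq (Finset.mem_Icc.1 ht).1
  rw [Finset.sum_sub_distrib] at e1
  have e2 : ∫ w, (OptimisticPath.regretBound D (fun t => X t w) (fun t => v t w)
      (fun t => η t w) n + 2 * ∑ t ∈ Finset.Icc 1 n,
        γ t w * (‖a t w - a (t - 1) w‖ * ‖v (t - 1) w‖)) ∂P ≤
      ∫ w, (OptimisticPath.pathConst κ L B D * √(1 + psum (fun s => g s w) n) + D ^ 4) ∂P := by
    refine integral_mono_ae (bR.add ((EssBdd.const _).mul
      (EssBdd.sum _ fun t _ => bd t))).integrable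
      (((EssBdd.const _).mul bW).add (EssBdd.const _)).integrable ?_
    filter_upwards [h.g_le] with w hw
    exact (h.path w).regretBound_add_le hq hκ hL hw D n
  rw [integral_add bR.integrable ((EssBdd.const _).mul (EssBdd.sum _ fun t _ => bd t)).integrable,
    integral_add ((EssBdd.const _).mul bW).integrable (integrable_const _), integral_const_mul,
    integral_const_mul, integral_finsetSum _ fun t _ => (bd t).integrable] at e2
  rw [integral_sub bR.integrable ((EssBdd.const _).mul (EssBdd.sum _ fun t _ => bc t)).integrable,
    integral_const_mul, integral_finsetSum _ fun t _ => (bc t).integrable]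
  simp only [integral_const, probReal_univ, one_smul] at e2
  linarith

/-- The reverse direction to the regret bound: since `γ t` is known before iteration `t - 1` and
lies in `[0, 1]`, the second moment hypothesis applies with `γ t` as weight. -/
theorem integral_rpow_le (h : NoisyRun P ℱ qh κ κ' L B X₁ X Y Xh v a g γ η)
    (hq0 : 0 < qh) (hq : qh ≤ 1 / 4) (n : ℕ) :
    ∫ w, (1 + psum (fun s => g s w) n) ^ (qh + 1 / 2) ∂P ≤
      κ' * ∑ t ∈ Finset.Icc 1 n, ∫ w, γ t w * ‖a (t - 1) w‖ ^ 2 ∂P + (1 + B) := by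
  have bg : ∀ t, EssBdd P (fun w => γ t w * g (t - 1) w) := fun t =>
    (h.bdd_γ hq t).mul (h.bdd_g (t - 1))
  have e1 : ∫ w, (1 + psum (fun s => g s w) n) ^ (qh + 1 / 2) ∂P ≤
      ∫ w, (∑ t ∈ Finset.Icc 1 n, γ t w * g (t - 1) w + (1 + B)) ∂P := by
    refine integral_mono_ae (h.bdd_rpow (by linarith) n).integrable
      ((EssBdd.sum _ fun t _ => bg t).add (EssBdd.const _)).integrable ?_
    filter_upwards [h.g_le] with w hw
    exact (h.path w).rpow_le_sum hq hw n
  rw [integral_add (EssBdd.sum _ fun t _ => bg t).integrable (integrable_const _),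
    integral_finsetSum _ fun t _ => (bg t).integrable] at e1
  simp only [integral_const, probReal_univ, one_smul] at e1
  have e2 : ∑ t ∈ Finset.Icc 1 n, ∫ w, γ t w * g (t - 1) w ∂P ≤
      ∑ t ∈ Finset.Icc 1 n, κ' * ∫ w, γ t w * ‖a (t - 1) w‖ ^ 2 ∂P := by
    refine Finset.sum_le_sum fun t ht => ?_
    rcases Nat.lt_or_ge t 2 with h2 | h2
    · have h0 : t - 1 = 0 := by have := (Finset.mem_Icc.1 ht).1; omega
      rw [h0]
      have ha0 : ∀ w, a 0 w = 0 := fun w => (h.path w).a_zero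
      have hg0 : ∀ w, g 0 w = 0 := fun w => (h.path w).g_zero
      simp [ha0, hg0]
    · exact h.second_moment (t - 1) (by omega) (γ t) ((h.γ_meas t).mono (ℱ.mono (by omega)) le_rfl)
        (fun w => (h.path w).γ_nonneg t) (fun w => (h.path w).γ_le_one hq t)
  rw [← Finset.mul_sum] at e2
  linarith

/-- Against a comparator with nonnegative regret the cumulative size of the feedback stays
bounded in mean. -/
theorem exists_integral_sqrt_le (hq0 : 0 < qh) (hq : qh ≤ 1 / 4) (hκ : 0 ≤ κ) (hκ' : 0 ≤ κ')
    (hL : 0 ≤ L) (B D : ℝ) :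
    ∃ C : ℝ, ∀ {Ω : Type*} {mΩ : MeasurableSpace Ω} {P : Measure Ω} [IsProbabilityMeasure P]
      {ℱ : Filtration ℕ mΩ} {X₁ : E} {X Y Xh v a : ℕ → Ω → E} {g γ η : ℕ → Ω → ℝ},
      NoisyRun P ℱ qh κ κ' L B X₁ X Y Xh v a g γ η →
      ∀ p : E, ‖X₁ - p‖ ^ 2 ≤ D ^ 2 → (∀ t ≥ 1, ∀ w, 0 ≤ inner ℝ (a t w) (Xh t w - p)) →
      ∀ n, ∫ w, √(1 + psum (fun s => g s w) n) ∂P ≤ C := by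
  have hc := OptimisticPath.pathConst_nonneg (B := B) (D := D) hκ hL
  set c := OptimisticPath.pathConst κ L B D
  -- Combining the two estimates gives `E (1 + G)^(q̂ + 1/2) ≤ (κ' c / 2) E√(1 + G) + const`. The
  -- extra `1` in the coefficient leaves a full copy of `E√(1 + G)` after absorption.
  obtain ⟨C', hC'⟩ := exists_mul_sqrt_le hq0 (κ' * c / 2 + 1) (by positivity)
  refine ⟨κ' * D ^ 4 / 2 + (1 + B) + 2 * C', fun {Ω mΩ P _ ℱ X₁ X Y Xh v a g γ η} h p hp hpos n => ?_⟩
  have hreg := h.integral_regretBound_le hκ hL hq D n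
  have hrpow := h.integral_rpow_le hq0 hq n
  have bR := (h.bdd_regretBound hκ D n).sub ((EssBdd.const (2 : ℝ)).mul
    (EssBdd.sum (Finset.Icc 1 n) fun t _ =>
      (h.bdd_γ hq t).mul ((h.bdd_v hκ t).inner (h.bdd_v hκ (t - 1)))))
  have bi : ∀ t ∈ Finset.Icc 1 n, EssBdd P (fun w => inner ℝ (v t w) (Xh t w - p)) :=
    fun t ht => (h.bdd_v hκ t).inner
      ((h.bdd_Xh hκ hq (Finset.mem_Icc.1 ht).1).sub (EssBdd.const p))
  -- The regret with `v` is nonnegative only in expectation: `Xh t - p` is known before the draw, so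
  -- `v t` may be replaced by `a t`, and `hpos` applies.
  have hnn : 0 ≤ ∫ w, (2 * ∑ t ∈ Finset.Icc 1 n, inner ℝ (v t w) (Xh t w - p)) ∂P := by
    rw [integral_const_mul, integral_finsetSum _ fun t ht => (bi t ht).integrable]
    refine mul_nonneg zero_le_two (Finset.sum_nonneg fun t ht => ?_)
    have ht1 := (Finset.mem_Icc.1 ht).1
    have hm := h.mean t ht1 (fun w => Xh t w - p) ((h.Xh_meas ht1).sub measurable_const)
      ((h.bdd_Xh hκ hq ht1).sub (EssBdd.const p))
    have hi : ∫ w, inner ℝ (v t w) (Xh t w - p) ∂P = ∫ w, inner ℝ (a t w) (Xh t w - p) ∂P := by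
      simpa only [real_inner_comm] using hm
    rw [hi]
    exact integral_nonneg fun w => hpos t ht1 w
  have hle : ∫ w, (2 * ∑ t ∈ Finset.Icc 1 n, inner ℝ (v t w) (Xh t w - p)) ∂P ≤
      ∫ w, (OptimisticPath.regretBound D (fun t => X t w) (fun t => v t w) (fun t => η t w) n -
        2 * ∑ t ∈ Finset.Icc 1 n, γ t w * inner ℝ (v t w) (v (t - 1) w)) ∂P :=
    integral_mono ((EssBdd.const _).mul (EssBdd.sum _ bi)).integrable bR.integrable fun w =>
      (h.path w).regret_le n (by rw [h.X_one]; exact hp)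
  have habs : (κ' * c / 2 + 1) * ∫ w, √(1 + psum (fun s => g s w) n) ∂P ≤
      (1 / 2) * ∫ w, (1 + psum (fun s => g s w) n) ^ (qh + 1 / 2) ∂P + C' := by
    have := integral_mono ((EssBdd.const (κ' * c / 2 + 1)).mul (h.bdd_sqrt n)).integrable
      (((EssBdd.const (1 / 2 : ℝ)).mul (h.bdd_rpow (r := qh + 1 / 2) (by linarith) n)).add
        (EssBdd.const C')).integrable
      fun w => hC' _ (by linarith [psum_nonneg (h.path w).g_nonneg n])
    rw [integral_const_mul, integral_add ((EssBdd.const (1 / 2 : ℝ)).mul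
      (h.bdd_rpow (r := qh + 1 / 2) (by linarith) n)).integrable (integrable_const _),
      integral_const_mul] at this
    simpa using this
  have hW0 : 0 ≤ ∫ w, √(1 + psum (fun s => g s w) n) ∂P :=
    integral_nonneg fun w => Real.sqrt_nonneg _
  set I := ∫ w, √(1 + psum (fun s => g s w) n) ∂P
  set A := ∑ t ∈ Finset.Icc 1 n, ∫ w, γ t w * ‖a (t - 1) w‖ ^ 2 ∂P
  have h1 : κ' * A ≤ κ' * ((c * I + D ^ 4) / 2) :=
    mul_le_mul_of_nonneg_left (by linarith) hκ'
  have h2 : 0 ≤ κ' * c * I := by positivity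
  linarith

/-- The `L¹` norm of the accumulated noise is controlled by the root of the cumulative size of
the feedback. -/
theorem integral_norm_noise_le (h : NoisyRun P ℱ qh κ κ' L B X₁ X Y Xh v a g γ η)
    (hκ : 0 ≤ κ) (n : ℕ) :
    ∫ w, ‖∑ t ∈ Finset.Icc 1 n, (v t w - a t w)‖ ∂P ≤
      (1 / 2) * (κ * (2 * √(1 + 2 * B)) + 1) * ∫ w, √(1 + psum (fun s => g s w) n) ∂P := by
  have bξ : ∀ t, EssBdd P (fun w => v t w - a t w) := fun t => (h.bdd_v hκ t).sub (h.bdd_a t)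
  have bM : ∀ n, EssBdd P (fun w => ∑ t ∈ Finset.Icc 1 n, (v t w - a t w)) := fun n =>
    EssBdd.sum _ fun t _ => bξ t
  have bu := h.bdd_weight
  have bv : ∀ t, EssBdd P (fun w => weight g t w * ‖v t w‖ ^ 2) := fun t =>
    (bu t).mul (h.bdd_v hκ t).norm.sq
  -- A weighted form of orthogonality of martingale increments: the weight is predictable and
  -- decreasing, so passing to the next weight only lowers the left-hand side.
  have key : ∀ n, ∫ w, weight g (n + 1) w * ‖∑ t ∈ Finset.Icc 1 n, (v t w - a t w)‖ ^ 2 ∂P ≤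
      ∑ t ∈ Finset.Icc 1 n, ∫ w, weight g t w * ‖v t w‖ ^ 2 ∂P := by
    intro n
    induction n with
    | zero => simp
    | succ n ih =>
      rw [Finset.sum_Icc_succ_top (by omega)]
      set M : Ω → E := fun w => ∑ t ∈ Finset.Icc 1 n, (v t w - a t w) with hM
      have hMm : Measurable[ℱ n] M := Finset.measurable_fun_sum _ fun t ht => by
        have := (Finset.mem_Icc.1 ht).2
        exact ((h.v_meas t).mono (ℱ.mono this) le_rfl).sub
          ((h.a_meas t).mono (ℱ.mono (by omega)) le_rfl)
      have i1 := ((bu (n + 1)).mul (bM n).norm.sq)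
      have i2 := ((bu (n + 1)).smul (bM n)).inner (bξ (n + 1))
      have i3 := ((bu (n + 1)).smul (h.bdd_a (n + 1))).inner (bξ (n + 1))
      have zero_of : ∀ f : Ω → E, Measurable[ℱ n] f → EssBdd P f →
          ∫ w, inner ℝ (f w) (v (n + 1) w - a (n + 1) w) ∂P = 0 := by
        intro f hf bf
        simp_rw [inner_sub_right]
        rw [integral_sub (bf.inner (h.bdd_v hκ _)).integrable
          (bf.inner (h.bdd_a _)).integrable, h.mean (n + 1) (by omega) f hf bf, sub_self]
      have z2 := zero_of (fun w => weight g (n + 1) w • M w) ((h.weight_meas (n + 1)).smul hMm) ((bu (n + 1)).smul (bM n))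
      have z3 := zero_of (fun w => weight g (n + 1) w • a (n + 1) w) ((h.weight_meas (n + 1)).smul (h.a_meas (n + 1)))
        ((bu (n + 1)).smul (h.bdd_a (n + 1)))
      have z4 : 0 ≤ ∫ w, weight g (n + 1) w * ‖a (n + 1) w‖ ^ 2 ∂P :=
        integral_nonneg fun w => mul_nonneg (h.weight_pos _ w).le (by positivity)
      -- `‖v - a‖²` is written as `‖v‖² - 2⟨a, v - a⟩ - ‖a‖²`; the last term is dropped, and both
      -- inner products with `v - a` integrate to zero.
      have hstep : ∫ w, weight g (n + 1 + 1) w *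
            ‖∑ t ∈ Finset.Icc 1 (n + 1), (v t w - a t w)‖ ^ 2 ∂P ≤
          ∫ w, (weight g (n + 1) w * ‖M w‖ ^ 2 +
            2 * inner ℝ (weight g (n + 1) w • M w) (v (n + 1) w - a (n + 1) w) +
            weight g (n + 1) w * ‖v (n + 1) w‖ ^ 2 -
            2 * inner ℝ (weight g (n + 1) w • a (n + 1) w) (v (n + 1) w - a (n + 1) w)) ∂P := by
        refine integral_mono ((bu _).mul (bM (n + 1)).norm.sq).integrable
          (((i1.add ((EssBdd.const _).mul i2)).add (bv _)).sub
            ((EssBdd.const _).mul i3)).integrable fun w => ?_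
        have hsum : ∑ t ∈ Finset.Icc 1 (n + 1), (v t w - a t w) =
            M w + (v (n + 1) w - a (n + 1) w) := by
          rw [Finset.sum_Icc_succ_top (by omega)]
        have hle := mul_le_mul_of_nonneg_right (h.weight_antitone w (Nat.le_succ (n + 1)))
          (sq_nonneg ‖M w + (v (n + 1) w - a (n + 1) w)‖)
        simp only [Nat.succ_eq_add_one] at hle
        dsimp only
        rw [hsum]
        refine hle.trans ?_
        rw [norm_add_sq_real, norm_sub_sq_real, inner_smul_left, inner_smul_left,
          inner_sub_right (a (n + 1) w), real_inner_self_eq_norm_sq,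
          real_inner_comm (v (n + 1) w) (a (n + 1) w)]
        simp only [conj_trivial]
        have := mul_nonneg (h.weight_pos (n + 1) w).le (sq_nonneg ‖a (n + 1) w‖)
        nlinarith
      rw [integral_sub ((i1.add ((EssBdd.const _).mul i2)).add (bv _)).integrable
          ((EssBdd.const _).mul i3).integrable,
        integral_add (i1.add ((EssBdd.const _).mul i2)).integrable (bv _).integrable,
        integral_add i1.integrable ((EssBdd.const _).mul i2).integrable, integral_const_mul,
        integral_const_mul, z2, z3] at hstep
      linarith
  have hW := h.bdd_sqrt n
  have h1 : ∫ w, ‖∑ t ∈ Finset.Icc 1 n, (v t w - a t w)‖ ∂P ≤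
      ∫ w, ((1 / 2) * (weight g (n + 1) w * ‖∑ t ∈ Finset.Icc 1 n, (v t w - a t w)‖ ^ 2) +
        (1 / 2) * √(1 + psum (fun s => g s w) n)) ∂P := by
    refine integral_mono (bM n).norm.integrable
      (((EssBdd.const _).mul ((bu _).mul (bM n).norm.sq)).add
        ((EssBdd.const _).mul hW)).integrable fun w => ?_
    have h0 := psum_nonneg (h.path w).g_nonneg (n + 1 - 2)
    have hs : 0 < √(1 + psum (fun s => g s w) (n + 1 - 2)) := Real.sqrt_pos.2 (by linarith)
    have hs' : √(1 + psum (fun s => g s w) (n + 1 - 2)) ≤ √(1 + psum (fun s => g s w) n) :=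
      Real.sqrt_le_sqrt (by
        linarith [psum_mono (h.path w).g_nonneg (show n + 1 - 2 ≤ n by omega)])
    dsimp only [weight]
    set m := ‖∑ t ∈ Finset.Icc 1 n, (v t w - a t w)‖
    set s := √(1 + psum (fun s => g s w) (n + 1 - 2))
    -- The arithmetic–geometric mean inequality with the random scale `s`, the inverse of the
    -- weight, returns from second moments to the `L¹` norm.
    have h3 : m ≤ (1 / 2) * (s⁻¹ * m ^ 2) + (1 / 2) * s := by
      have h4 : (1 / 2) * (s⁻¹ * m ^ 2) + (1 / 2) * s = (m ^ 2 + s ^ 2) / (2 * s) := by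
        field_simp
      rw [h4, le_div_iff₀ (by positivity)]
      nlinarith [sq_nonneg (m - s)]
    linarith
  rw [integral_add ((EssBdd.const _).mul ((bu _).mul (bM n).norm.sq)).integrable
      ((EssBdd.const _).mul hW).integrable, integral_const_mul, integral_const_mul] at h1
  have h2 : ∑ t ∈ Finset.Icc 1 n, ∫ w, weight g t w * ‖v t w‖ ^ 2 ∂P ≤
      κ * (2 * √(1 + 2 * B)) * ∫ w, √(1 + psum (fun s => g s w) n) ∂P := by
    rw [← integral_finsetSum _ fun t _ => (bv t).integrable, ← integral_const_mul]
    refine integral_mono_ae (EssBdd.sum _ fun t _ => bv t).integrable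
      ((EssBdd.const _).mul hW).integrable ?_
    filter_upwards [h.g_le] with w hw
    calc ∑ t ∈ Finset.Icc 1 n, weight g t w * ‖v t w‖ ^ 2
        ≤ ∑ t ∈ Finset.Icc 1 n, κ * (g t w / √(1 + psum (fun s => g s w) (t - 2))) := by
          refine Finset.sum_le_sum fun t _ => ?_
          calc weight g t w * ‖v t w‖ ^ 2 ≤ weight g t w * (κ * g t w) :=
                mul_le_mul_of_nonneg_left ((h.path w).v_le t) (h.weight_pos t w).le
            _ = _ := by rw [weight, div_eq_mul_inv]; ring
      _ ≤ _ := by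
          rw [← Finset.mul_sum, mul_assoc]
          exact mul_le_mul_of_nonneg_left (sum_div_sqrt_le (h.path w).g_nonneg hw n) hκ
  have := key n
  linarith

/-- Constant regret: the regret, uniformly over all comparators at distance at most `D` from the
initial point, is bounded by a random variable whose mean is bounded independently of the
horizon. -/
theorem exists_regret_le (hq0 : 0 < qh) (hq : qh ≤ 1 / 4) (hκ : 0 ≤ κ) (hκ' : 0 ≤ κ')
    (hL : 0 ≤ L) (B D : ℝ) (hD : 0 ≤ D) :
    ∃ C : ℝ, ∀ {Ω : Type*} {mΩ : MeasurableSpace Ω} {P : Measure Ω} [IsProbabilityMeasure P]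
      {ℱ : Filtration ℕ mΩ} {X₁ : E} {X Y Xh v a : ℕ → Ω → E} {g γ η : ℕ → Ω → ℝ},
      NoisyRun P ℱ qh κ κ' L B X₁ X Y Xh v a g γ η →
      ∀ p : E, ‖X₁ - p‖ ^ 2 ≤ D ^ 2 → (∀ t ≥ 1, ∀ w, 0 ≤ inner ℝ (a t w) (Xh t w - p)) →
      ∀ n, ∃ Φ : Ω → ℝ, Integrable Φ P ∧ ∫ w, Φ w ∂P ≤ C ∧ ∀ w, ∀ p' : E, ‖X₁ - p'‖ ^ 2 ≤ D ^ 2 →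
        ∑ t ∈ Finset.Icc 1 n, inner ℝ (a t w) (Xh t w - p') ≤ Φ w := by
  obtain ⟨C, hC⟩ := exists_integral_sqrt_le (E := E) hq0 hq hκ hκ' hL B D
  have hc := OptimisticPath.pathConst_nonneg (B := B) (D := D) hκ hL
  set c := OptimisticPath.pathConst κ L B D
  refine ⟨(1 / 2) * (c * C + D ^ 4) + D * ((1 / 2) * (κ * (2 * √(1 + 2 * B)) + 1) * C),
    fun {Ω mΩ P _ ℱ X₁ X Y Xh v a g γ η} h p hp hpos n => ?_⟩
  have hI := hC h p hp hpos n
  have hreg := h.integral_regretBound_le hκ hL hq D n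
  have hnoise := h.integral_norm_noise_le hκ n
  have bR := (h.bdd_regretBound hκ D n).sub ((EssBdd.const (2 : ℝ)).mul
    (EssBdd.sum (Finset.Icc 1 n) fun t _ =>
      (h.bdd_γ hq t).mul ((h.bdd_v hκ t).inner (h.bdd_v hκ (t - 1)))))
  have bξ : ∀ t, EssBdd P (fun w => v t w - a t w) := fun t => (h.bdd_v hκ t).sub (h.bdd_a t)
  have bN : EssBdd P (fun w => ∑ t ∈ Finset.Icc 1 n, inner ℝ (v t w - a t w) (Xh t w - X₁)) :=
    EssBdd.sum _ fun t ht =>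
      (bξ t).inner ((h.bdd_Xh hκ hq (Finset.mem_Icc.1 ht).1).sub (EssBdd.const X₁))
  have bM : EssBdd P (fun w => ‖∑ t ∈ Finset.Icc 1 n, (v t w - a t w)‖) :=
    (EssBdd.sum _ fun t _ => bξ t).norm
  -- The noise `⟨v_t - a_t, X_{t+1/2} - p'⟩` is split at `X₁`: the part with `X_{t+1/2} - X₁` has
  -- mean zero, and the part with `X₁ - p'` is bounded uniformly in `p'` by Cauchy–Schwarz. Hence
  -- `Φ` does not involve the comparator.
  refine ⟨fun w => (1 / 2) * (OptimisticPath.regretBound D (fun t => X t w) (fun t => v t w)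
      (fun t => η t w) n - 2 * ∑ t ∈ Finset.Icc 1 n, γ t w * inner ℝ (v t w) (v (t - 1) w)) -
      ∑ t ∈ Finset.Icc 1 n, inner ℝ (v t w - a t w) (Xh t w - X₁) +
      D * ‖∑ t ∈ Finset.Icc 1 n, (v t w - a t w)‖,
    ((((EssBdd.const _).mul bR).sub bN).add ((EssBdd.const _).mul bM)).integrable, ?_, ?_⟩
  · have hN0 : ∫ w, ∑ t ∈ Finset.Icc 1 n, inner ℝ (v t w - a t w) (Xh t w - X₁) ∂P = 0 := by
      rw [integral_finsetSum _ fun t ht => ((bξ t).inner ((h.bdd_Xh hκ hq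
        (Finset.mem_Icc.1 ht).1).sub (EssBdd.const X₁))).integrable]
      refine Finset.sum_eq_zero fun t ht => ?_
      have ht1 := (Finset.mem_Icc.1 ht).1
      have bx := (h.bdd_Xh hκ hq ht1).sub (EssBdd.const (P := P) X₁)
      have hm := h.mean t ht1 (fun w => Xh t w - X₁) ((h.Xh_meas ht1).sub measurable_const) bx
      have he : ∀ w, inner ℝ (v t w - a t w) (Xh t w - X₁) =
          inner ℝ (Xh t w - X₁) (v t w) - inner ℝ (Xh t w - X₁) (a t w) := fun w => by
        rw [real_inner_comm, inner_sub_right]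
      simp_rw [he]
      rw [integral_sub (bx.inner (h.bdd_v hκ t)).integrable (bx.inner (h.bdd_a t)).integrable,
        hm, sub_self]
    rw [integral_add (((EssBdd.const _).mul bR).sub bN).integrable
        ((EssBdd.const _).mul bM).integrable,
      integral_sub ((EssBdd.const _).mul bR).integrable bN.integrable, hN0, integral_const_mul,
      integral_const_mul, sub_zero]
    have hA : 0 ≤ ∑ t ∈ Finset.Icc 1 n, ∫ w, γ t w * ‖a (t - 1) w‖ ^ 2 ∂P :=
      Finset.sum_nonneg fun t _ => integral_nonneg fun w =>
        mul_nonneg ((h.path w).γ_nonneg t) (sq_nonneg _)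
    have h1 := mul_le_mul_of_nonneg_left hI hc
    have h2 := mul_le_mul_of_nonneg_left hI
      (show 0 ≤ (1 / 2) * (κ * (2 * √(1 + 2 * B)) + 1) by positivity)
    have h3 := mul_le_mul_of_nonneg_left (hnoise.trans h2) hD
    linarith
  · intro w p' hp'
    have h1 := (h.path w).regret_le n (p := p') (D := D) (by rw [h.X_one]; exact hp')
    have h2 : ∑ t ∈ Finset.Icc 1 n, inner ℝ (a t w) (Xh t w - p') =
        ∑ t ∈ Finset.Icc 1 n, inner ℝ (v t w) (Xh t w - p') -
        ∑ t ∈ Finset.Icc 1 n, inner ℝ (v t w - a t w) (Xh t w - X₁) -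
        inner ℝ (∑ t ∈ Finset.Icc 1 n, (v t w - a t w)) (X₁ - p') := by
      rw [sum_inner, ← Finset.sum_sub_distrib, ← Finset.sum_sub_distrib]
      refine Finset.sum_congr rfl fun t _ => ?_
      rw [sub_sub, ← inner_add_right, sub_add_sub_cancel, ← inner_sub_left, sub_sub_cancel]
    have h3 : -inner ℝ (∑ t ∈ Finset.Icc 1 n, (v t w - a t w)) (X₁ - p') ≤
        D * ‖∑ t ∈ Finset.Icc 1 n, (v t w - a t w)‖ := by
      have h4 := neg_le_of_abs_le
        (abs_real_inner_le_norm (∑ t ∈ Finset.Icc 1 n, (v t w - a t w)) (X₁ - p'))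
      have h5 := mul_le_mul_of_nonneg_left (abs_le_of_sq_le_sq' hp' hD).2
        (norm_nonneg (∑ t ∈ Finset.Icc 1 n, (v t w - a t w)))
      linarith
    rw [h2]
    dsimp only
    linarith

end NoisyRun

end

/-! ### Measurability of the quantization map -/

/-- Needed because types and level indices are themselves random: a measurable selection among
countably many measurable functions is measurable. -/
theorem measurable_select {Ω ι β : Type*} {m : MeasurableSpace Ω} [MeasurableSpace ι]
    [MeasurableSpace β] [Countable ι] [MeasurableSingletonClass ι] {f : Ω → ι}
    (hf : Measurable f) {F : ι → Ω → β} (hF : ∀ i, Measurable (F i)) :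
    Measurable (fun w => F (f w) w) := by
  have : Measurable (fun p : ι × Ω => F p.1 p.2) := measurable_from_prod_countable_right hF
  exact this.comp (hf.prodMk measurable_id)

section measurability

variable {Ω : Type*} {m : MeasurableSpace Ω}

theorem LevelSeq.measurable_round {ℓ : Ω → LevelSeq} (hn : Measurable fun w => (ℓ w).num)
    (hv : ∀ j, Measurable fun w => (ℓ w).val j) {u θ : Ω → ℝ} (hu : Measurable u)
    (hθ : Measurable θ) : Measurable (fun w => (ℓ w).round (u w) (θ w)) := by
  classical
  have hτ : Measurable (fun w => (ℓ w).τ (u w)) := by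
    have h1 : ∀ n, Measurable (fun w => Nat.findGreatest (fun j => (ℓ w).val j ≤ u w) n) :=
      fun n => measurable_findGreatest fun k _ => measurableSet_le (hv k) hu
    unfold LevelSeq.τ
    convert measurable_select hn h1
  have hlow : Measurable (fun w => (ℓ w).val ((ℓ w).τ (u w))) := measurable_select hτ hv
  have hup : Measurable (fun w => (ℓ w).val ((ℓ w).τ (u w) + 1)) :=
    measurable_select hτ (F := fun n w => (ℓ w).val (n + 1)) fun n => hv (n + 1)
  have hξ : Measurable (fun w => (ℓ w).ξ (u w)) := (hu.sub hlow).div (hup.sub hlow)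
  unfold LevelSeq.round
  convert Measurable.ite (measurableSet_lt hθ hξ) hup hlow

theorem measurable_sign : Measurable Real.sign := by
  unfold Real.sign
  exact Measurable.ite measurableSet_Iio measurable_const
    (Measurable.ite measurableSet_Ioi measurable_const measurable_const)

theorem measurable_lqNorm {d : ℕ} (q : ℕ) : Measurable (lqNorm (d := d) q) := by
  unfold lqNorm
  fun_prop

theorem Scheme.measurable_quantize {d M : ℕ} {𝕃 : Ω → Scheme d M} (q : ℕ)
    (ht : ∀ i, Measurable fun w => (𝕃 w).typ i)
    (hn : ∀ m, Measurable fun w => ((𝕃 w).lev m).num)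
    (hv : ∀ m j, Measurable fun w => ((𝕃 w).lev m).val j)
    {x : Ω → Vec d} (hx : Measurable x) {θ : Ω → Fin d → ℝ} (hθ : Measurable θ) :
    Measurable (fun w => (𝕃 w).quantize q (x w) (θ w)) := by
  unfold Scheme.quantize
  refine (WithLp.measurable_toLp 2 _).comp (measurable_pi_iff.2 fun i => ?_)
  have hxi : Measurable fun w => x w i := by fun_prop
  have hθi : Measurable fun w => θ w i := by fun_prop
  have hq : Measurable fun w => lqNorm q (x w) := (measurable_lqNorm q).comp hx
  refine (hq.mul (measurable_sign.comp hxi)).mul ?_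
  have hu : Measurable fun w => |x w i| / lqNorm q (x w) :=
    (continuous_abs.measurable.comp hxi).div hq
  exact measurable_select (ht i)
    (F := fun n w => ((𝕃 w).lev n).round (|x w i| / lqNorm q (x w)) (θ w i))
    fun n => LevelSeq.measurable_round (hn n) (hv n) hu hθi

theorem measurable_nodeAvg {d K : ℕ} {v : Ω → Fin K → Vec d}
    (hv : ∀ k, Measurable fun w => v w k) : Measurable (fun w => nodeAvg (v w)) :=
  (Finset.measurable_fun_sum Finset.univ fun k _ => hv k).const_smul (1 / (K : ℝ))

end measurability

/-! ### Averages over one draw -/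

/-- The law of the draws of one iteration. -/
abbrev drawLaw {S : Type*} [MeasurableSpace S] (ν : Measure S) (K d : ℕ) :
    Measure (Draw S K d) :=
  Measure.pi (fun _ : Fin K => ν.prod (Measure.pi (fun _ : Fin d => LevelSeq.unif)))

/-- An unbiased bounded oracle whose second moment is proportional to the squared norm of the
mean. -/
structure BoundedOracle {d : ℕ} {S : Type*} [MeasurableSpace S] (A : Vec d → Vec d)
    (g : Vec d → S → Vec d) (ν : Measure S) (R c : ℝ) : Prop where
  meas : Measurable (Function.uncurry g)
  integrable : ∀ x, Integrable (g x) ν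
  mean : ∀ x, ∫ s, g x s ∂ν = A x
  bound : ∀ x, ∀ᵐ s ∂ν, ‖g x s‖ ≤ R
  second_moment : ∀ x, ∫ s, ‖g x s‖ ^ 2 ∂ν ≤ c * ‖A x‖ ^ 2

namespace BoundedOracle

variable {d K M : ℕ} {S : Type*} [MeasurableSpace S] {A : Vec d → Vec d} {g : Vec d → S → Vec d}
  {ν : Measure S} [IsProbabilityMeasure ν] {R c : ℝ}

theorem meas_right (h : BoundedOracle A g ν R c) (x : Vec d) : Measurable (g x) :=
  h.meas.comp measurable_prodMk_left

theorem norm_mean_le (h : BoundedOracle A g ν R c) (x : Vec d) : ‖A x‖ ≤ R := by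
  rw [← h.mean x]
  simpa using norm_integral_le_of_norm_le_const (h.bound x)

theorem bound_nonneg (h : BoundedOracle A g ν R c) : 0 ≤ R :=
  (norm_nonneg _).trans (h.norm_mean_le 0)

theorem norm_sq_le (h : BoundedOracle A g ν R c) (x : Vec d) :
    ∀ᵐ s ∂ν, ‖g x s‖ ^ 2 ≤ R ^ 2 := by
  filter_upwards [h.bound x] with s hs
  exact pow_le_pow_left₀ (norm_nonneg _) hs 2

theorem integrable_norm_sq (h : BoundedOracle A g ν R c) (x : Vec d) :
    Integrable (fun s => ‖g x s‖ ^ 2) ν := by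
  refine Integrable.of_bound ((h.meas_right x).norm.pow_const 2).aestronglyMeasurable (R ^ 2) ?_
  filter_upwards [h.norm_sq_le x] with s hs
  rwa [Real.norm_of_nonneg (by positivity)]

theorem measurable_quantize (h : BoundedOracle A g ν R c) (𝕃 : Scheme d M) (q : ℕ) (x : Vec d) :
    Measurable (fun p : S × (Fin d → ℝ) => 𝕃.quantize q (g x p.1) p.2) :=
  Scheme.measurable_quantize q (fun _ => measurable_const) (fun _ => measurable_const)
    (fun _ _ => measurable_const) ((h.meas_right x).comp measurable_fst) measurable_snd

theorem ae_norm_sq_quantize_le (h : BoundedOracle A g ν R c) (𝕃 : Scheme d M) {q : ℕ}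
    (hq : 1 ≤ q) (x : Vec d) :
    ∀ᵐ p ∂(ν.prod (Measure.pi (fun _ : Fin d => LevelSeq.unif))),
      ‖𝕃.quantize q (g x p.1) p.2‖ ^ 2 ≤ (d : ℝ) ^ 3 * R ^ 2 := by
  have := (measurePreserving_fst (μ := ν)
    (ν := Measure.pi (fun _ : Fin d => LevelSeq.unif))).quasiMeasurePreserving.ae (h.norm_sq_le x)
  filter_upwards [this] with p hp
  exact (𝕃.norm_sq_quantize_le hq _ _).trans (by gcongr)

theorem integrable_quantize (h : BoundedOracle A g ν R c) (𝕃 : Scheme d M) {q : ℕ}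
    (hq : 1 ≤ q) (x : Vec d) :
    Integrable (fun p : S × (Fin d → ℝ) => 𝕃.quantize q (g x p.1) p.2)
      (ν.prod (Measure.pi (fun _ : Fin d => LevelSeq.unif))) := by
  refine Integrable.of_bound (h.measurable_quantize 𝕃 q x).aestronglyMeasurable
    (√((d : ℝ) ^ 3 * R ^ 2)) ?_
  filter_upwards [h.ae_norm_sq_quantize_le 𝕃 hq x] with p hp
  exact Real.le_sqrt_of_sq_le hp

theorem integral_quantize (h : BoundedOracle A g ν R c) (𝕃 : Scheme d M) {q : ℕ}
    (hq : 1 ≤ q) (x : Vec d) :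
    ∫ p, 𝕃.quantize q (g x p.1) p.2 ∂(ν.prod (Measure.pi (fun _ : Fin d => LevelSeq.unif))) =
      A x := by
  have hint := h.integrable_quantize 𝕃 hq x
  ext i
  have h1 := (EuclideanSpace.proj i : Vec d →L[ℝ] ℝ).integral_comp_comm hint
  have h2 := (EuclideanSpace.proj i : Vec d →L[ℝ] ℝ).integral_comp_comm (h.integrable x)
  rw [h.mean x] at h2
  simp only [PiLp.proj_apply] at h1 h2
  have hint_i := (EuclideanSpace.proj i : Vec d →L[ℝ] ℝ).integrable_comp hint
  simp only [PiLp.proj_apply] at hint_i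
  rw [← h1, ← h2, integral_prod _ hint_i]
  exact integral_congr_ae (ae_of_all _ fun s => 𝕃.integral_quantize_apply hq (g x s) i)

theorem integrable_quantize_eval (h : BoundedOracle A g ν R c) (𝕃 : Scheme d M) {q : ℕ}
    (hq : 1 ≤ q) (x : Vec d) (k : Fin K) :
    Integrable (fun z : Draw S K d => 𝕃.quantize q (g x (z k).1) (z k).2) (drawLaw ν K d) :=
  integrable_comp_eval
    (μ := fun _ : Fin K => ν.prod (Measure.pi (fun _ : Fin d => LevelSeq.unif)))
    (f := fun p => 𝕃.quantize q (g x p.1) p.2) (h.integrable_quantize 𝕃 hq x)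

theorem integrable_nodeAvg (h : BoundedOracle A g ν R c) (𝕃 : Scheme d M) {q : ℕ}
    (hq : 1 ≤ q) (x : Vec d) :
    Integrable (fun z : Draw S K d => nodeAvg fun k => 𝕃.quantize q (g x (z k).1) (z k).2)
      (drawLaw ν K d) := by
  exact (integrable_finsetSum _ fun k _ => h.integrable_quantize_eval 𝕃 hq x k).smul (1 / (K : ℝ))

theorem integral_nodeAvg (hK : 0 < K) (h : BoundedOracle A g ν R c) (𝕃 : Scheme d M) {q : ℕ}
    (hq : 1 ≤ q) (x : Vec d) :
    ∫ z : Draw S K d, nodeAvg (fun k => 𝕃.quantize q (g x (z k).1) (z k).2) ∂(drawLaw ν K d) =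
      A x := by
  have hint := h.integrable_quantize 𝕃 hq x
  have he : ∀ k : Fin K,
      ∫ z : Draw S K d, 𝕃.quantize q (g x (z k).1) (z k).2 ∂(drawLaw ν K d) = A x := fun k => by
    rw [← h.integral_quantize 𝕃 hq x]
    exact integral_comp_eval
      (μ := fun _ : Fin K => ν.prod (Measure.pi (fun _ : Fin d => LevelSeq.unif)))
      (f := fun p => 𝕃.quantize q (g x p.1) p.2) hint.aestronglyMeasurable
  unfold nodeAvg
  rw [integral_smul, integral_finsetSum _ fun k _ => h.integrable_quantize_eval 𝕃 hq x k, Finset.sum_congr rfl fun k _ => he k,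
    Finset.sum_const, Finset.card_univ, Fintype.card_fin, ← Nat.cast_smul_eq_nsmul ℝ, smul_smul,
    one_div_mul_cancel (by positivity), one_smul]

end BoundedOracle

/-! ### Averages over a draw that is independent of the past -/

section independence

variable {Ω Ω' E : Type*} {mΩ : MeasurableSpace Ω} {m' : MeasurableSpace Ω'}
  [mE : MeasurableSpace E] {P : Measure Ω} [IsProbabilityMeasure P] {past : Ω → Ω'}
  {Z : Ω → E} {ρ : Measure E} [IsProbabilityMeasure ρ]

theorem map_prod_of_indep (hp : Measurable past) (hZ : Measurable Z) (hlaw : P.map Z = ρ)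
    (hind : IndepFun past Z P) : P.map (fun w => (past w, Z w)) = (P.map past).prod ρ := by
  rw [(indepFun_iff_map_prod_eq_prod_map_map hp.aemeasurable hZ.aemeasurable).1 hind, hlaw]

/-- The freezing principle: an independent draw may be averaged first with the past held fixed,
which replaces conditional expectations throughout. -/
theorem integral_of_indep (hp : Measurable past) (hZ : Measurable Z) (hlaw : P.map Z = ρ)
    (hind : IndepFun past Z P) {F : Ω' × E → ℝ} (hF : Measurable F)
    (hint : Integrable (fun w => F (past w, Z w)) P) :
    ∫ w, F (past w, Z w) ∂P = ∫ w, ∫ z, F (past w, z) ∂ρ ∂P := by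
  have hmap := map_prod_of_indep hp hZ hlaw hind
  have hprob : IsProbabilityMeasure (P.map past) := Measure.isProbabilityMeasure_map hp.aemeasurable
  have hint' : Integrable F ((P.map past).prod ρ) := by
    rw [← hmap]
    exact (integrable_map_measure hF.aestronglyMeasurable (hp.prodMk hZ).aemeasurable).2 hint
  have h1 : ∫ w, F (past w, Z w) ∂P = ∫ y, F y ∂((P.map past).prod ρ) := by
    rw [← hmap, integral_map (hp.prodMk hZ).aemeasurable hF.aestronglyMeasurable]
  rw [h1, integral_prod _ hint', integral_map hp.aemeasurable
    hF.stronglyMeasurable.integral_prod_right'.aestronglyMeasurable]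

theorem ae_of_indep (hp : Measurable past) (hZ : Measurable Z) (hlaw : P.map Z = ρ)
    (hind : IndepFun past Z P) {p : Ω' × E → Prop} (hpm : MeasurableSet {y | p y})
    (h : ∀ x, ∀ᵐ z ∂ρ, p (x, z)) : ∀ᵐ w ∂P, p (past w, Z w) := by
  have hmap := map_prod_of_indep hp hZ hlaw hind
  have hprob : IsProbabilityMeasure (P.map past) := Measure.isProbabilityMeasure_map hp.aemeasurable
  have h1 : ∀ᵐ y ∂((P.map past).prod ρ), p y :=
    (Measure.ae_prod_iff_ae_ae hpm).2 (ae_of_all _ h)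
  rw [← hmap] at h1
  exact ae_of_ae_map (hp.prodMk hZ).aemeasurable h1

end independence

/-- The quantized feedback of one iteration, as a function of the past and of the draw. -/
def feedback {Ω S : Type*} {d K M : ℕ} (q : ℕ) (g : Vec d → S → Vec d) (𝕃 : Ω → Scheme d M)
    (x : Ω → Vec d) (p : Ω × Draw S K d) (k : Fin K) : Vec d :=
  (𝕃 p.1).quantize q (g (x p.1) (p.2 k).1) (p.2 k).2

section step

variable {d K M : ℕ} {S : Type*} [MeasurableSpace S] {A : Vec d → Vec d} {g : Vec d → S → Vec d}
  {ν : Measure S} [IsProbabilityMeasure ν] {R c : ℝ}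
  {Ω Ω' : Type*} {mΩ : MeasurableSpace Ω} {m' : MeasurableSpace Ω'}
  {P : Measure Ω} [IsProbabilityMeasure P] {past : Ω → Ω'} {Z : Ω → Draw S K d}
  {𝕃 : Ω' → Scheme d M} {x : Ω' → Vec d} {q : ℕ}

theorem measurable_feedback (hg : Measurable (Function.uncurry g))
    (ht : ∀ i, Measurable fun w => (𝕃 w).typ i)
    (hn : ∀ m, Measurable fun w => ((𝕃 w).lev m).num)
    (hv : ∀ m j, Measurable fun w => ((𝕃 w).lev m).val j) (hx : Measurable x) (k : Fin K) :
    Measurable (fun p : Ω' × Draw S K d => feedback q g 𝕃 x p k) := by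
  have hk : Measurable (fun p : Ω' × Draw S K d => p.2 k) :=
    (measurable_pi_apply k).comp measurable_snd
  exact Scheme.measurable_quantize q (fun i => (ht i).comp measurable_fst)
    (fun m => (hn m).comp measurable_fst) (fun m j => (hv m j).comp measurable_fst)
    (hg.comp ((hx.comp measurable_fst).prodMk (measurable_fst.comp hk)))
    (measurable_snd.comp hk)

variable (h : BoundedOracle A g ν R c) (hq : 1 ≤ q) (hp : Measurable past) (hZ : Measurable Z)
  (hlaw : P.map Z = drawLaw ν K d) (hind : IndepFun past Z P)
  (hf : ∀ k, Measurable (fun p : Ω' × Draw S K d => feedback q g 𝕃 x p k))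
include h hq hp hZ hlaw hind hf

theorem ae_norm_sq_feedback_le :
    ∀ᵐ w ∂P, ∀ k, ‖feedback q g 𝕃 x (past w, Z w) k‖ ^ 2 ≤ (d : ℝ) ^ 3 * R ^ 2 := by
  refine ae_all_iff.2 fun k => ?_
  refine ae_of_indep (p := fun p => ‖feedback q g 𝕃 x p k‖ ^ 2 ≤ (d : ℝ) ^ 3 * R ^ 2) hp hZ hlaw
    hind (measurableSet_le ((hf k).norm.pow_const 2) measurable_const) fun y => ?_
  exact (measurePreserving_eval (fun _ : Fin K =>
    ν.prod (Measure.pi (fun _ : Fin d => LevelSeq.unif))) k).quasiMeasurePreserving.ae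
    (h.ae_norm_sq_quantize_le (𝕃 y) hq (x y))

theorem essBdd_feedback (k : Fin K) :
    EssBdd P (fun w => feedback q g 𝕃 x (past w, Z w) k) := by
  refine ⟨((hf k).comp (hp.prodMk hZ)).aestronglyMeasurable, √((d : ℝ) ^ 3 * R ^ 2), ?_⟩
  filter_upwards [ae_norm_sq_feedback_le h hq hp hZ hlaw hind hf] with w hw
  exact Real.le_sqrt_of_sq_le (hw k)

theorem integral_inner_feedback (hK : 0 < K) {u : Ω' → Vec d} (hu : Measurable u)
    (hub : EssBdd P (fun w => u (past w))) :
    ∫ w, inner ℝ (u (past w)) (nodeAvg (feedback q g 𝕃 x (past w, Z w))) ∂P =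
      ∫ w, inner ℝ (u (past w)) (A (x (past w))) ∂P := by
  have hbv : EssBdd P (fun w => nodeAvg (feedback q g 𝕃 x (past w, Z w))) :=
    (EssBdd.const (1 / (K : ℝ))).smul (EssBdd.sum _ fun k _ =>
      essBdd_feedback h hq hp hZ hlaw hind hf k)
  have hF : Measurable (fun p : Ω' × Draw S K d =>
      inner ℝ (u p.1) (nodeAvg (feedback q g 𝕃 x p))) :=
    (hu.comp measurable_fst).inner (measurable_nodeAvg hf)
  rw [integral_of_indep hp hZ hlaw hind hF (hub.inner hbv).integrable]
  refine integral_congr_ae (ae_of_all _ fun w => ?_)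
  dsimp only
  have hint := h.integrable_nodeAvg (K := K) (𝕃 (past w)) hq (x (past w))
  have := integral_inner (𝕜 := ℝ) hint (u (past w))
  rw [BoundedOracle.integral_nodeAvg hK h (𝕃 (past w)) hq (x (past w))] at this
  exact this

/-- With the past frozen, the rounding numbers are removed by the pointwise factor `d³`, and the
remaining oracle sample has second moment at most `c ‖A x‖²`. -/
theorem integral_mul_norm_sq_feedback_le {r : Ω' → ℝ} (hr : Measurable r) (hr0 : ∀ y, 0 ≤ r y)
    (hr1 : ∀ y, r y ≤ 1) (hxA : EssBdd P (fun w => A (x (past w)))) (k : Fin K) :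
    ∫ w, r (past w) * ‖feedback q g 𝕃 x (past w, Z w) k‖ ^ 2 ∂P ≤
      (d : ℝ) ^ 3 * c * ∫ w, r (past w) * ‖A (x (past w))‖ ^ 2 ∂P := by
  have hbr : EssBdd P (fun w => r (past w)) :=
    .of_mem_Icc (hr.comp hp) (fun w => hr0 _) (ae_of_all _ fun w => hr1 _)
  have hbv := essBdd_feedback h hq hp hZ hlaw hind hf k
  have hF : Measurable (fun p : Ω' × Draw S K d => r p.1 * ‖feedback q g 𝕃 x p k‖ ^ 2) :=
    (hr.comp measurable_fst).mul ((hf k).norm.pow_const 2)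
  rw [integral_of_indep hp hZ hlaw hind hF (hbr.mul hbv.norm.sq).integrable, ← integral_const_mul]
  refine integral_mono_of_nonneg
    (ae_of_all _ fun w => integral_nonneg fun z => mul_nonneg (hr0 _) (sq_nonneg _))
    ((EssBdd.const ((d : ℝ) ^ 3 * c)).mul (hbr.mul hxA.norm.sq)).integrable
    (ae_of_all _ fun w => ?_)
  dsimp only
  rw [integral_const_mul]
  have hle : ∫ z : Draw S K d, ‖feedback q g 𝕃 x (past w, z) k‖ ^ 2 ∂(drawLaw ν K d) ≤
      (d : ℝ) ^ 3 * (c * ‖A (x (past w))‖ ^ 2) := by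
    have e1 : ∫ z : Draw S K d, ‖g (x (past w)) (z k).1‖ ^ 2 ∂(drawLaw ν K d) =
        ∫ s, ‖g (x (past w)) s‖ ^ 2 ∂ν := by
      have hm := ((h.meas_right (x (past w))).norm.pow_const 2)
      have h1 := integral_comp_eval (μ := fun _ : Fin K =>
        ν.prod (Measure.pi (fun _ : Fin d => LevelSeq.unif))) (i := k)
        (f := fun p => ‖g (x (past w)) p.1‖ ^ 2) (hm.comp measurable_fst).aestronglyMeasurable
      have h2 := integral_map (μ := ν.prod (Measure.pi (fun _ : Fin d => LevelSeq.unif)))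
        measurable_fst.aemeasurable hm.aestronglyMeasurable
      rw [measurePreserving_fst.map_eq] at h2
      exact h1.trans h2.symm
    have i1 : Integrable (fun z : Draw S K d => ‖g (x (past w)) (z k).1‖ ^ 2) (drawLaw ν K d) := by
      have h1 := h.integrable_norm_sq (x (past w))
      have h2 := (measurePreserving_fst (μ := ν)
        (ν := Measure.pi (fun _ : Fin d => LevelSeq.unif))).comp
        (measurePreserving_eval (fun _ : Fin K =>
          ν.prod (Measure.pi (fun _ : Fin d => LevelSeq.unif))) k)
      exact (h2.integrable_comp h1.aestronglyMeasurable).2 h1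
    calc _ ≤ ∫ z : Draw S K d, (d : ℝ) ^ 3 * ‖g (x (past w)) (z k).1‖ ^ 2 ∂(drawLaw ν K d) :=
          integral_mono_of_nonneg (ae_of_all _ fun z => sq_nonneg _) (i1.const_mul _)
            (ae_of_all _ fun z => (𝕃 (past w)).norm_sq_quantize_le hq _ _)
      _ ≤ _ := by
          rw [integral_const_mul, e1]
          exact mul_le_mul_of_nonneg_left (h.second_moment _) (by positivity)
  calc _ ≤ r (past w) * ((d : ℝ) ^ 3 * (c * ‖A (x (past w))‖ ^ 2)) :=
        mul_le_mul_of_nonneg_left hle (hr0 _)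
    _ = _ := by ring

end step

/-! ### The algorithm as a noisy run of optimistic dual averaging -/

/-- The aggregate squared dual norm `∑_k ‖v_k‖_*² / K²` of the feedback of all nodes. -/
def aggSq {d K : ℕ} (N : Seminorm ℝ (Vec d)) (v : Fin K → Vec d) : ℝ :=
  ∑ k, dualNorm N (v k) ^ 2 / (K : ℝ) ^ 2

theorem aggSq_nonneg {d K : ℕ} (N : Seminorm ℝ (Vec d)) (v : Fin K → Vec d) : 0 ≤ aggSq N v :=
  Finset.sum_nonneg fun _ _ => by positivity

theorem norm_nodeAvg_sq_le {d K : ℕ} {N : Seminorm ℝ (Vec d)} {c : ℝ}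
    (hc : ∀ v, ‖v‖ ≤ c * dualNorm N v) (v : Fin K → Vec d) :
    ‖nodeAvg v‖ ^ 2 ≤ K * c ^ 2 * aggSq N v := by
  have h1 : ‖∑ k, v k‖ ^ 2 ≤ K * ∑ k, ‖v k‖ ^ 2 := by
    refine (pow_le_pow_left₀ (norm_nonneg _) (norm_sum_le _ _) 2).trans ?_
    simpa using sq_sum_le_card_mul_sum_sq (s := Finset.univ) (f := fun k => ‖v k‖)
  have h2 : ∑ k, ‖v k‖ ^ 2 ≤ ∑ k, c ^ 2 * dualNorm N (v k) ^ 2 :=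
    Finset.sum_le_sum fun k _ => by
      rw [← mul_pow]
      exact pow_le_pow_left₀ (norm_nonneg _) (hc _) 2
  rw [← Finset.mul_sum] at h2
  unfold nodeAvg aggSq
  rw [norm_smul, mul_pow, Real.norm_of_nonneg (by positivity), ← Finset.sum_div]
  calc (1 / (K : ℝ)) ^ 2 * ‖∑ k, v k‖ ^ 2
      ≤ (1 / (K : ℝ)) ^ 2 * (K * (c ^ 2 * ∑ k, dualNorm N (v k) ^ 2)) := by
        gcongr
        exact h1.trans (by gcongr)
    _ = _ := by ring

theorem aggSq_le {d K : ℕ} {N : Seminorm ℝ (Vec d)} (hN : ∀ x, N x = 0 → x = 0) {C : ℝ}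
    (hC : ∀ v, dualNorm N v ≤ C * ‖v‖) (v : Fin K → Vec d) :
    aggSq N v ≤ C ^ 2 / (K : ℝ) ^ 2 * ∑ k, ‖v k‖ ^ 2 := by
  unfold aggSq
  rw [Finset.mul_sum]
  refine Finset.sum_le_sum fun k _ => ?_
  rw [div_mul_eq_mul_div, ← mul_pow]
  gcongr
  · exact dualNorm_nonneg hN _
  · exact hC _

theorem dualNorm_zero {d : ℕ} {N : Seminorm ℝ (Vec d)} (hN : ∀ x, N x = 0 → x = 0) :
    dualNorm N (0 : Vec d) = 0 :=
  le_antisymm (dualNorm_le_of_forall fun x _ => by simp) (dualNorm_nonneg hN 0)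

theorem aggSq_zero {d K : ℕ} {N : Seminorm ℝ (Vec d)} (hN : ∀ x, N x = 0 → x = 0)
    {v : Fin K → Vec d} (hv : ∀ k, v k = 0) : aggSq N v = 0 := by
  simp [aggSq, hv, dualNorm_zero hN]

theorem nodeAvg_zero {d K : ℕ} {v : Fin K → Vec d} (hv : ∀ k, v k = 0) : nodeAvg v = 0 := by
  simp [nodeAvg, hv]

/-- The mean feedback `A X_{t+1/2}`, which is `0` at the fictitious iteration `0`. -/
def meanFeedback {d : ℕ} (A : Vec d → Vec d) (Xh : ℕ → Vec d) (t : ℕ) : Vec d :=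
  if t = 0 then 0 else A (Xh t)

theorem meanFeedback_of_pos {d : ℕ} (A : Vec d → Vec d) (Xh : ℕ → Vec d) {t : ℕ} (ht : 1 ≤ t) :
    meanFeedback A Xh t = A (Xh t) := if_neg (by omega)

theorem IsRun.optimisticPath {S : Type*} {d K M : ℕ} {N : Seminorm ℝ (Vec d)}
    (hN : ∀ x, N x = 0 → x = 0) {qh : ℝ} {q : ℕ} {g : Vec d → S → Vec d} {X₁ : Vec d}
    {𝕃 : ℕ → Scheme d M} {z : ℕ → Draw S K d} {X Y Xh : ℕ → Vec d} {V : ℕ → Fin K → Vec d}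
    (h : IsRun N qh q g X₁ 𝕃 z X Y Xh V) {c L : ℝ} (hc : ∀ v, ‖v‖ ≤ c * dualNorm N v)
    {A : Vec d → Vec d} (hA : ∀ x y, ‖A x - A y‖ ≤ L * ‖x - y‖) :
    OptimisticPath qh (K * c ^ 2) L X Y Xh (fun t => nodeAvg (V t)) (meanFeedback A Xh)
      (fun t => aggSq N (V t)) (γAlt N qh V) (ηAlt N V X) where
  Y_one := h.Y_one
  v_zero := nodeAvg_zero h.V_zero
  a_zero := if_pos rfl
  g_zero := aggSq_zero hN h.V_zero
  extrapolate := h.extrapolate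
  dual_step := h.dual_step
  primal_step t ht := by rw [h.X_one]; exact h.primal_step t ht
  γ_eq _ := rfl
  η_eq t := by
    have h0 : 0 ≤ psum (fun s => aggSq N (V s) + ‖X s - X (s + 1)‖ ^ 2) (t - 2) :=
      psum_nonneg (fun s => add_nonneg (aggSq_nonneg N _) (by positivity)) _
    rw [Real.sqrt_eq_rpow, ← Real.rpow_neg (by linarith)]
    rfl
  g_nonneg _ := aggSq_nonneg N _
  v_le t := norm_nodeAvg_sq_le hc (V t)
  a_lip s hs t ht := by
    rw [meanFeedback_of_pos A Xh hs, meanFeedback_of_pos A Xh ht]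
    exact hA _ _

section run

variable {d K M q : ℕ} {N : Seminorm ℝ (Vec d)} (hN : ∀ x, N x = 0 → x = 0)
  {S : Type*} [MeasurableSpace S] {A : Vec d → Vec d} {g : Vec d → S → Vec d}
  {ν : Measure S} {R c : ℝ}
  {Ω : Type*} {mΩ : MeasurableSpace Ω} {P : Measure Ω} {qh : ℝ} {X₁ : Vec d}
  {ℱ : Filtration ℕ mΩ} {Z : ℕ → Ω → Draw S K d} {𝕃 : ℕ → Ω → Scheme d M}
  {X Y Xh : ℕ → Ω → Vec d} {V : ℕ → Ω → Fin K → Vec d}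
  (hg : Measurable (Function.uncurry g)) (hR : IsRandomness P ν ℱ Z 𝕃)
  (hrun : ∀ w, IsRun N qh q g X₁ (fun t => 𝕃 t w) (fun t => Z t w)
          (fun t => X t w) (fun t => Y t w) (fun t => Xh t w) (fun t => V t w))
include hN

theorem measurable_aggSq {m : MeasurableSpace Ω} {v : Ω → Fin K → Vec d}
    (hv : ∀ k, Measurable fun w => v w k) : Measurable (fun w => aggSq N (v w)) :=
  Finset.measurable_fun_sum _ fun k _ =>
    (((continuous_dualNorm hN).measurable.comp (hv k)).pow_const 2).div_const _

theorem measurable_extrapolated {m : MeasurableSpace Ω} {t : ℕ} (ht : 1 ≤ t)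
    (hrun : ∀ w, IsRun N qh q g X₁ (fun t => 𝕃 t w) (fun t => Z t w)
          (fun t => X t w) (fun t => Y t w) (fun t => Xh t w) (fun t => V t w))
    (hX : Measurable (X t)) (hV : ∀ s < t, ∀ k, Measurable fun w => V s w k) :
    Measurable (Xh t) := by
  have he : Xh t = fun w => X t w - γAlt N qh (fun t => V t w) t • nodeAvg (V (t - 1) w) :=
    funext fun w => (hrun w).extrapolate t ht
  have hγ : Measurable fun w => γAlt N qh (fun t => V t w) t :=
    (measurable_const.add (Finset.measurable_fun_sum _ fun s hs =>
      measurable_aggSq hN (hV s (by have := Finset.mem_Icc.1 hs; omega)))).pow_const _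
  rw [he]
  exact hX.sub (hγ.smul (measurable_nodeAvg (hV (t - 1) (by omega))))

include hg hR hrun

/-- Strong induction is needed because the learning rates use the whole history; the draws of
iteration `n` first enter through `V n`, hence also `Y (n + 1)` and `X (n + 1)`. -/
theorem measurable_iterates (n : ℕ) :
    Measurable[ℱ n] (X (n + 1)) ∧ Measurable[ℱ n] (Y (n + 1)) ∧
      ∀ k, Measurable[ℱ n] fun w => V n w k := by
  induction n using Nat.strong_induction_on with
  | _ n ih =>
    have hXs : ∀ s, 1 ≤ s → s ≤ n → Measurable[ℱ n] (X s) := fun s hs hs' => by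
      obtain ⟨r, rfl⟩ := Nat.exists_eq_add_of_le' hs
      exact (ih r (by omega)).1.mono (ℱ.mono (by omega)) le_rfl
    have hVs : ∀ s < n, ∀ k, Measurable[ℱ n] fun w => V s w k := fun s hs k =>
      ((ih s hs).2.2 k).mono (ℱ.mono hs.le) le_rfl
    rcases n with _ | n
    · have hX : X 1 = fun _ => X₁ := funext fun w => (hrun w).X_one
      have hY : Y 1 = fun _ => 0 := funext fun w => (hrun w).Y_one
      have hV : ∀ k, (fun w => V 0 w k) = fun _ => 0 := fun k => funext fun w => (hrun w).V_zero k
      refine ⟨?_, ?_, fun k => ?_⟩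
      · rw [zero_add, hX]; exact measurable_const
      · rw [zero_add, hY]; exact measurable_const
      · rw [hV]; exact measurable_const
    · have hXh : Measurable[ℱ (n + 1)] (Xh (n + 1)) :=
        measurable_extrapolated hN (by omega) hrun (hXs _ (by omega) le_rfl) hVs
      have hZ := hR.draw_adapted n
      have hle : ℱ n ≤ ℱ (n + 1) := ℱ.mono (Nat.le_succ n)
      have hV : ∀ k, Measurable[ℱ (n + 1)] fun w => V (n + 1) w k := fun k => by
        have he : (fun w => V (n + 1) w k) = fun w => (𝕃 (n + 1) w).quantize q
            (g (Xh (n + 1) w) (Z (n + 1) w k).1) (Z (n + 1) w k).2 :=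
          funext fun w => (hrun w).query (n + 1) (by omega) k
        have hZk : Measurable[ℱ (n + 1)] fun w => Z (n + 1) w k := (measurable_pi_apply k).comp hZ
        rw [he]
        exact Scheme.measurable_quantize q
          (fun i => (hR.typ_predictable n i).mono hle le_rfl)
          (fun m => (hR.num_predictable n m).mono hle le_rfl)
          (fun m j => (hR.val_predictable n m j).mono hle le_rfl)
          (hg.comp (hXh.prodMk (measurable_fst.comp hZk))) (measurable_snd.comp hZk)
      have hY : Measurable[ℱ (n + 1)] (Y (n + 1 + 1)) := by
        have he : Y (n + 1 + 1) = fun w => Y (n + 1) w - nodeAvg (V (n + 1) w) :=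
          funext fun w => (hrun w).dual_step (n + 1) (by omega)
        rw [he]
        exact ((ih n (by omega)).2.1.mono hle le_rfl).sub (measurable_nodeAvg hV)
      refine ⟨?_, hY, hV⟩
      have he : X (n + 1 + 1) = fun w => X₁ +
          ηAlt N (fun t => V t w) (fun t => X t w) (n + 1 + 1) • Y (n + 1 + 1) w :=
        funext fun w => (hrun w).primal_step (n + 1) (by omega)
      have hη : Measurable[ℱ (n + 1)]
          fun w => ηAlt N (fun t => V t w) (fun t => X t w) (n + 1 + 1) := by
        refine (measurable_const.add (Finset.measurable_fun_sum _ fun s hs => ?_)).pow_const _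
        have hs := Finset.mem_Icc.1 hs
        have hd : Measurable[ℱ (n + 1)] fun w => X s w - X (s + 1) w :=
          (hXs s hs.1 (by omega)).sub (hXs (s + 1) (by omega) (by omega))
        exact (measurable_aggSq hN (hVs s (by omega))).add
          ((measurable_norm.comp hd).pow_const 2)
      rw [he]
      exact measurable_const.add (hη.smul hY)

variable [IsProbabilityMeasure P] [IsProbabilityMeasure ν]

/-- A run of the quantized algorithm is a noisy run of optimistic dual averaging. -/
theorem noisyRun (hK : 0 < K) (hq : 1 ≤ q) (hor : BoundedOracle A g ν R c) {c₁ c₂ L : ℝ}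
    (h₁ : ∀ v, ‖v‖ ≤ c₁ * dualNorm N v) (h₂ : ∀ v, dualNorm N v ≤ c₂ * ‖v‖)
    (hA : ∀ x y, ‖A x - A y‖ ≤ L * ‖x - y‖) (hL : 0 ≤ L) :
    NoisyRun P ℱ qh (K * c₁ ^ 2) (c₂ ^ 2 / (K : ℝ) ^ 2 * (K * ((d : ℝ) ^ 3 * c))) L
      (c₂ ^ 2 / (K : ℝ) ^ 2 * (K * ((d : ℝ) ^ 3 * R ^ 2))) X₁ X Y Xh
      (fun t w => nodeAvg (V t w)) (fun t w => meanFeedback A (fun t => Xh t w) t)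
      (fun t w => aggSq N (V t w)) (fun t w => γAlt N qh (fun t => V t w) t)
      (fun t w => ηAlt N (fun t => V t w) (fun t => X t w) t) := by
  have hmeas := measurable_iterates hN hg hR hrun
  have hXm : ∀ t ≥ 1, Measurable[ℱ (t - 1)] (X t) := fun t ht => by
    obtain ⟨r, rfl⟩ := Nat.exists_eq_add_of_le' ht
    exact (hmeas r).1
  have hVm : ∀ t k, Measurable[ℱ t] fun w => V t w k := fun t => (hmeas t).2.2
  have hXhm : ∀ n, Measurable[ℱ n] (Xh (n + 1)) := fun n =>
    measurable_extrapolated hN (by omega) hrun (hXm (n + 1) (by omega)) fun s hs k =>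
      (hVm s k).mono (ℱ.mono (by omega)) le_rfl
  have hAc : Continuous A :=
    (LipschitzWith.of_dist_le_mul (K := ⟨L, hL⟩) fun x y => by
      rw [dist_eq_norm, dist_eq_norm]; exact hA x y).continuous
  have hAm := hAc.measurable
  have hid : ∀ n, @Measurable Ω Ω mΩ (ℱ n) id := fun n => measurable_id'' (ℱ.le n)
  have hZm : ∀ n, Measurable (Z (n + 1)) := fun n =>
    (hR.draw_adapted n).mono (ℱ.le _) le_rfl
  -- The past is represented by the identity map into `Ω` carrying the σ-algebra `ℱ n`; functions of
  -- the past are then exactly the `ℱ n`-measurable functions on `Ω`.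
  have hind : ∀ n, @IndepFun Ω Ω (Draw S K d) mΩ (ℱ n) _ id (Z (n + 1)) P := fun n => by
    refine (@IndepFun_iff_Indep Ω Ω (Draw S K d) mΩ (ℱ n) _ id (Z (n + 1)) P).2 ?_
    rw [MeasurableSpace.comap_id]
    exact (hR.draw_indep n).symm
  have hf : ∀ n k, Measurable[(ℱ n).prod inferInstance] fun p : Ω × Draw S K d =>
      feedback q g (𝕃 (n + 1)) (Xh (n + 1)) p k := fun n k =>
    measurable_feedback (m' := ℱ n) hg (hR.typ_predictable n) (hR.num_predictable n)
      (hR.val_predictable n) (hXhm n) k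
  have hVe : ∀ n w, V (n + 1) w = feedback q g (𝕃 (n + 1)) (Xh (n + 1)) (id w, Z (n + 1) w) :=
    fun n w => funext fun k => (hrun w).query (n + 1) (by omega) k
  have hbA : ∀ n, EssBdd P fun w => A (Xh (n + 1) w) := fun n =>
    ⟨(hAm.comp ((hXhm n).mono (ℱ.le n) le_rfl)).aestronglyMeasurable, R,
      ae_of_all _ fun w => hor.norm_mean_le _⟩
  refine
    { path := fun w => (hrun w).optimisticPath hN h₁ hA
      X_one := fun w => (hrun w).X_one
      v_meas := fun t => measurable_nodeAvg (hVm t)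
      g_meas := fun t => measurable_aggSq hN (hVm t)
      X_meas := hXm
      a_meas := fun t => ?_
      g_le := ?_
      a_bdd := ⟨R, fun t w => ?_⟩
      mean := fun t ht u hu hub => ?_
      second_moment := fun t ht r hr hr0 hr1 => ?_ }
  · rcases t with _ | n
    · exact measurable_const
    · exact hAm.comp (hXhm n)
  · refine ae_all_iff.2 fun t => ?_
    have hle : ∀ w, (∀ k, ‖V t w k‖ ^ 2 ≤ (d : ℝ) ^ 3 * R ^ 2) →
        aggSq N (V t w) ≤ c₂ ^ 2 / (K : ℝ) ^ 2 * (K * ((d : ℝ) ^ 3 * R ^ 2)) := fun w hw => by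
      refine (aggSq_le hN h₂ _).trans (mul_le_mul_of_nonneg_left ?_ (by positivity))
      have := Finset.sum_le_card_nsmul Finset.univ _ _ fun k (_ : k ∈ Finset.univ) => hw k
      simpa using this
    rcases t with _ | n
    · refine ae_of_all _ fun w => hle w fun k => ?_
      rw [(hrun w).V_zero k]
      rw [norm_zero, zero_pow two_ne_zero]
      positivity
    · filter_upwards [ae_norm_sq_feedback_le (m' := ℱ n) hor hq (hid n) (hZm n) (hR.draw_law n)
        (hind n) (hf n)] with w hw
      refine hle w fun k => ?_
      rw [hVe n w]
      exact hw k
  · unfold meanFeedback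
    split_ifs
    · rw [norm_zero]; exact hor.bound_nonneg
    · exact hor.norm_mean_le _
  · obtain ⟨n, rfl⟩ := Nat.exists_eq_add_of_le' ht
    simp only [hVe n]
    exact integral_inner_feedback (m' := ℱ n) hor hq (hid n) (hZm n) (hR.draw_law n)
      (hind n) (hf n) hK hu hub
  · obtain ⟨n, rfl⟩ := Nat.exists_eq_add_of_le' ht
    have hbr : EssBdd P r :=
      .of_mem_Icc (hr.mono (ℱ.le _) le_rfl) hr0 (ae_of_all _ hr1)
    have hbV : ∀ k, EssBdd P fun w => V (n + 1) w k := fun k => by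
      simp only [hVe n]
      exact essBdd_feedback (m' := ℱ n) hor hq (hid n) (hZm n) (hR.draw_law n) (hind n) (hf n) k
    have hsum : ∀ k, ∫ w, r w * ‖V (n + 1) w k‖ ^ 2 ∂P ≤
        (d : ℝ) ^ 3 * c * ∫ w, r w * ‖A (Xh (n + 1) w)‖ ^ 2 ∂P := fun k => by
      simp only [hVe n]
      exact integral_mul_norm_sq_feedback_le (m' := ℱ n) hor hq (hid n) (hZm n) (hR.draw_law n)
        (hind n) (hf n) hr hr0 hr1 (hbA n) k
    have hbi := fun k => hbr.mul (hbV k).norm.sq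
    calc ∫ w, r w * aggSq N (V (n + 1) w) ∂P
        ≤ ∫ w, c₂ ^ 2 / (K : ℝ) ^ 2 * ∑ k, r w * ‖V (n + 1) w k‖ ^ 2 ∂P := by
          refine integral_mono_of_nonneg
            (ae_of_all _ fun w => mul_nonneg (hr0 w) (aggSq_nonneg N _))
            ((EssBdd.const _).mul (EssBdd.sum _ fun k _ => hbi k)).integrable
            (ae_of_all _ fun w => ?_)
          refine (mul_le_mul_of_nonneg_left (aggSq_le hN h₂ _) (hr0 w)).trans (le_of_eq ?_)
          dsimp only
          rw [← Finset.mul_sum]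
          ring
      _ = c₂ ^ 2 / (K : ℝ) ^ 2 * ∑ k, ∫ w, r w * ‖V (n + 1) w k‖ ^ 2 ∂P := by
          rw [integral_const_mul, integral_finsetSum _ fun k _ => (hbi k).integrable]
      _ ≤ c₂ ^ 2 / (K : ℝ) ^ 2 *
          (K * ((d : ℝ) ^ 3 * c * ∫ w, r w * ‖A (Xh (n + 1) w)‖ ^ 2 ∂P)) := by
          refine mul_le_mul_of_nonneg_left ?_ (by positivity)
          have := Finset.sum_le_card_nsmul Finset.univ _ _ fun k (_ : k ∈ Finset.univ) => hsum k
          simpa using this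
      _ = _ := by
          simp only [meanFeedback_of_pos A _ ht]
          ring

end run

/-! ### The oracle in the Euclidean norm -/

/-- From `‖g‖² ≤ 2‖g - A x‖² + 2‖A x‖²`: relative noise keeps the second moment proportional to `‖A
x‖²`, with no additive constant. -/
theorem RelativeNoise.boundedOracle {d : ℕ} {S : Type*} [MeasurableSpace S] {ν : Measure S}
    [IsProbabilityMeasure ν] {N : Seminorm ℝ (Vec d)} (hN : ∀ x, N x = 0 → x = 0)
    {A : Vec d → Vec d} {g : Vec d → S → Vec d} {σR σ J c₁ c₂ : ℝ}
    (hg : Measurable (Function.uncurry g)) (h : RelativeNoise N A g ν σR)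
    (hJ : AlmostSurelyBounded N g ν J) (hσ : σR ≤ σ) (hσ0 : 0 ≤ σ) (hc₁ : 0 ≤ c₁)
    (h₁ : ∀ v, ‖v‖ ≤ c₁ * dualNorm N v) (h₂ : ∀ v, dualNorm N v ≤ c₂ * ‖v‖) :
    BoundedOracle A g ν (c₁ * J) (2 * (c₁ ^ 2 * (σ * c₂ ^ 2)) + 2) where
  meas := hg
  integrable := h.integrable
  mean := h.unbiased
  bound x := by
    filter_upwards [hJ x] with s hs
    exact (h₁ _).trans (mul_le_mul_of_nonneg_left hs hc₁)
  second_moment x := by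
    have hle : ∀ s, ‖g x s‖ ^ 2 ≤
        2 * (c₁ ^ 2 * dualNorm N (g x s - A x) ^ 2) + 2 * ‖A x‖ ^ 2 := fun s => by
      have e1 : ‖g x s‖ ≤ ‖g x s - A x‖ + ‖A x‖ := by
        simpa using norm_add_le (g x s - A x) (A x)
      have e2 := pow_le_pow_left₀ (norm_nonneg _) (h₁ (g x s - A x)) 2
      have e3 := pow_le_pow_left₀ (norm_nonneg _) e1 2
      rw [mul_pow] at e2
      nlinarith [sq_nonneg (‖g x s - A x‖ - ‖A x‖)]
    have hint := (((h.integrable_sq x).const_mul (c₁ ^ 2)).const_mul 2)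
    have e1 := integral_mono_of_nonneg (μ := ν) (ae_of_all _ fun s => sq_nonneg ‖g x s‖)
      (hint.add (integrable_const (2 * ‖A x‖ ^ 2))) (ae_of_all _ hle)
    rw [integral_add' hint (integrable_const _), integral_const_mul, integral_const_mul] at e1
    simp only [integral_const, probReal_univ, one_smul] at e1
    have e2 : ∫ s, dualNorm N (g x s - A x) ^ 2 ∂ν ≤ σ * (c₂ ^ 2 * ‖A x‖ ^ 2) := by
      refine (h.noise_le x).trans (mul_le_mul hσ ?_ (sq_nonneg _) hσ0)
      rw [← mul_pow]
      exact pow_le_pow_left₀ (dualNorm_nonneg hN _) (h₂ _) 2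
    have e3 := mul_le_mul_of_nonneg_left e2 (sq_nonneg c₁)
    linarith

/-! ### The gap function -/

section gap

variable {d : ℕ} {A : Vec d → Vec d} {𝒳 : Set (Vec d)} {R : ℝ}

theorem bddAbove_gap (hA : ∀ x, ‖A x‖ ≤ R) (h𝒳 : IsCompact 𝒳) (x : Vec d) :
    BddAbove ((fun p : Vec d => (inner ℝ (A p) (x - p) : ℝ)) '' 𝒳) := by
  obtain ⟨r, hr⟩ := h𝒳.isBounded.exists_norm_le
  refine ⟨R * (‖x‖ + r), ?_⟩
  rintro _ ⟨p, hp, rfl⟩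
  have h1 : ‖x - p‖ ≤ ‖x‖ + r := (norm_sub_le _ _).trans (by linarith [hr p hp])
  exact (real_inner_le_norm _ _).trans
    (mul_le_mul (hA p) h1 (norm_nonneg _) ((norm_nonneg _).trans (hA p)))

/-- The gap is a supremum of affine functions with slopes `A p`, which the bounded oracle keeps in a
ball of radius `R`. This Lipschitz estimate yields measurability and boundedness of the random gap.
-/
theorem gap_le_add (hA : ∀ x, ‖A x‖ ≤ R) (h𝒳 : IsCompact 𝒳) (hne : 𝒳.Nonempty) (x y : Vec d) :
    gap A 𝒳 x ≤ gap A 𝒳 y + R * dist x y := by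
  refine csSup_le (hne.image _) ?_
  rintro _ ⟨p, hp, rfl⟩
  have h1 : inner ℝ (A p) (y - p) ≤ gap A 𝒳 y :=
    le_csSup (bddAbove_gap hA h𝒳 y) ⟨p, hp, rfl⟩
  have h2 : inner ℝ (A p) (x - p) = inner ℝ (A p) (y - p) + inner ℝ (A p) (x - y) := by
    rw [← inner_add_right]
    congr 1
    abel
  have h3 : inner ℝ (A p) (x - y) ≤ R * dist x y := by
    rw [dist_eq_norm]
    exact (real_inner_le_norm _ _).trans (mul_le_mul_of_nonneg_right (hA p) (norm_nonneg _))
  dsimp only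
  linarith

theorem EssBdd.gap (hA : ∀ x, ‖A x‖ ≤ R) (h𝒳 : IsCompact 𝒳) (hne : 𝒳.Nonempty) {Ω : Type*}
    {mΩ : MeasurableSpace Ω} {P : Measure Ω} {x : Ω → Vec d} (hx : EssBdd P x) :
    EssBdd P (fun w => gap A 𝒳 (x w)) := by
  have hR : 0 ≤ R := (norm_nonneg _).trans (hA 0)
  have hc : Continuous (QODA.gap A 𝒳) :=
    (LipschitzWith.of_le_add_mul ⟨R, hR⟩ fun x y => gap_le_add hA h𝒳 hne x y).continuous
  obtain ⟨hm, r, hr⟩ := hx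
  refine ⟨hc.comp_aestronglyMeasurable hm, |QODA.gap A 𝒳 0| + R * r, ?_⟩
  filter_upwards [hr] with w hw
  have h1 := gap_le_add hA h𝒳 hne (x w) 0
  have h2 := gap_le_add hA h𝒳 hne 0 (x w)
  rw [dist_comm] at h2
  rw [dist_zero_right] at h1 h2
  have h3 := mul_le_mul_of_nonneg_left hw hR
  rw [Real.norm_eq_abs, abs_le]
  constructor <;> linarith [le_abs_self (QODA.gap A 𝒳 0), neg_abs_le (QODA.gap A 𝒳 0)]

/-- Monotonicity replaces `A p` by `A (Xh t)` in each summand, and `⟨A p, x - p⟩` is affine in `x`,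
so it commutes with averaging. -/
theorem gap_avgIterate_le (hmono : MonotoneOperator A) (hne : 𝒳.Nonempty)
    {T : ℕ} (hT : 1 ≤ T) {Xh : ℕ → Vec d} {b : ℝ}
    (hb : ∀ p ∈ 𝒳, ∑ t ∈ Finset.Icc 1 T, inner ℝ (A (Xh t)) (Xh t - p) ≤ b) :
    gap A 𝒳 (avgIterate Xh T) ≤ b / T := by
  have hT0 : (0 : ℝ) < T := by positivity
  refine csSup_le (hne.image _) ?_
  rintro _ ⟨p, hp, rfl⟩
  rw [le_div_iff₀ hT0]
  refine le_trans ?_ (hb p hp)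
  have he : (T : ℝ) • (avgIterate Xh T - p) = ∑ t ∈ Finset.Icc 1 T, (Xh t - p) := by
    unfold avgIterate
    rw [smul_sub, smul_smul, mul_one_div_cancel hT0.ne', one_smul, Finset.sum_sub_distrib,
      Finset.sum_const, Nat.card_Icc, Nat.add_sub_cancel, Nat.cast_smul_eq_nsmul]
  dsimp only
  rw [mul_comm, ← inner_smul_right, he, inner_sum]
  refine Finset.sum_le_sum fun t _ => ?_
  have := hmono (Xh t) p
  rw [inner_sub_left] at this
  linarith

end gap

/-- The problem is unconstrained, so `z - A z` is an admissible test point. -/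
theorem SolvesVI.eq_zero {d : ℕ} {A : Vec d → Vec d} {z : Vec d} (h : SolvesVI A z) :
    A z = 0 := by
  have := h (z - A z)
  rw [sub_sub_cancel_left, inner_neg_right, real_inner_self_eq_norm_sq] at this
  have h2 : ‖A z‖ ^ 2 = 0 := le_antisymm (by linarith) (sq_nonneg _)
  exact norm_eq_zero.1 (pow_eq_zero_iff two_ne_zero |>.1 h2)

theorem LipschitzOperator.norm_sub_le {d : ℕ} {N : Seminorm ℝ (Vec d)} {A : Vec d → Vec d}
    {L c₁ c₃ : ℝ} (h : LipschitzOperator N A L) (hc₁ : 0 ≤ c₁)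
    (h₁ : ∀ v, ‖v‖ ≤ c₁ * dualNorm N v) (h₃ : ∀ v, N v ≤ c₃ * ‖v‖) (x y : Vec d) :
    ‖A x - A y‖ ≤ c₁ * (|L| * c₃) * ‖x - y‖ :=
  calc ‖A x - A y‖ ≤ c₁ * dualNorm N (A x - A y) := h₁ _
    _ ≤ c₁ * (|L| * (c₃ * ‖x - y‖)) := by
      refine mul_le_mul_of_nonneg_left ((h x y).trans ?_) hc₁
      exact mul_le_mul (le_abs_self L) (h₃ _) (apply_nonneg N _) (abs_nonneg L)
    _ = _ := by ring

end QODA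

end

-- The main theorem

theorem theorem5
    {d K : ℕ} (hK : 0 < K)
    (N : Seminorm ℝ (QODA.Vec d)) (hN : ∀ x, N x = 0 → x = 0)
    (L J : ℝ) (qh : ℝ) (hqh : 0 < qh) (hqh' : qh ≤ 1 / 4)
    (σmax δ Dmin Dmax : ℝ) (hδ : 0 < δ) (hDmin : 0 < Dmin) :
    ∃ C : ℝ, 0 < C ∧
      ∀ (A : QODA.Vec d → QODA.Vec d),
        QODA.MonotoneOperator A →
        QODA.LipschitzOperator N A L →
      ∀ (S : Type*) [MeasurableSpace S] (ν : Measure S) [IsProbabilityMeasure ν]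
        (g : QODA.Vec d → S → QODA.Vec d) (σR : ℝ),
        Measurable (Function.uncurry g) →
        QODA.RelativeNoise N A g ν σR →
        QODA.AlmostSurelyBounded N g ν J →
        σR ≤ σmax →
      ∀ (X₁ xstar : QODA.Vec d) (𝒳 : Set (QODA.Vec d)) (D : ℝ),
        QODA.SolvesVI A xstar →
        IsCompact 𝒳 →
        𝒳 ∈ 𝓝 xstar →
        IsLUB ((fun p => ‖X₁ - p‖ ^ 2) '' 𝒳) (D ^ 2) →
        Dmin ≤ D → D ≤ Dmax →
      ∀ (Ω : Type*) [mΩ : MeasurableSpace Ω] (P : Measure Ω) [IsProbabilityMeasure P]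
        (ℱ : Filtration ℕ mΩ) (M q : ℕ) (Z : ℕ → Ω → QODA.Draw S K d)
        (𝕃 : ℕ → Ω → QODA.Scheme d M)
        (X Y Xh : ℕ → Ω → QODA.Vec d) (V : ℕ → Ω → Fin K → QODA.Vec d),
        1 ≤ q →
        QODA.IsRandomness P ν ℱ Z 𝕃 →
        (∀ w, QODA.IsRun N qh q g X₁ (fun t => 𝕃 t w) (fun t => Z t w)
          (fun t => X t w) (fun t => Y t w) (fun t => Xh t w) (fun t => V t w)) →
      ∀ T : ℕ, 1 ≤ T →
        (∀ t ∈ Finset.Icc 1 T, Integrable (fun w => (𝕃 t w).εQ q) P) →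
        δ ≤ σR * QODA.avgεQ P q 𝕃 T + QODA.avgεQ P q 𝕃 T + σR →
        Integrable (fun w => QODA.gap A 𝒳 (QODA.avgIterate (fun t => Xh t w) T)) P ∧
          ∫ w, QODA.gap A 𝒳 (QODA.avgIterate (fun t => Xh t w) T) ∂P ≤
            C * ((σR * QODA.avgεQ P q 𝕃 T + QODA.avgεQ P q 𝕃 T + σR) * D ^ 4 / T) := by
  obtain ⟨c₁, c₂, hc₁, hc₂, hdual⟩ := QODA.exists_dualNorm_bounds hN
  obtain ⟨c₃, hc₃, h₃⟩ := QODA.exists_seminorm_le N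
  have h₁ := fun v => (hdual v).1
  have h₂ := fun v => (hdual v).2
  set σ := max σmax 0
  have hσ0 : 0 ≤ σ := le_max_right _ _
  have hL : 0 ≤ c₁ * (|L| * c₃) := by positivity
  set c := 2 * (c₁ ^ 2 * (σ * c₂ ^ 2)) + 2
  have hc : 0 ≤ c := by positivity
  -- The regret constant is fixed before the problem instance, so it uses the worst radius `Dmax`
  -- and noise level `σmax`, truncated at `0` because their signs are not prescribed.
  obtain ⟨C, hC⟩ := QODA.NoisyRun.exists_regret_le (E := QODA.Vec d)
    (κ := K * c₁ ^ 2) (κ' := c₂ ^ 2 / (K : ℝ) ^ 2 * (K * ((d : ℝ) ^ 3 * c)))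
    hqh hqh' (by positivity) (by positivity) hL
    (c₂ ^ 2 / (K : ℝ) ^ 2 * (K * ((d : ℝ) ^ 3 * (c₁ * J) ^ 2))) (max Dmax 0) (le_max_right _ _)
  have hden : 0 < δ * Dmin ^ 4 := by positivity
  refine ⟨(|C| + 1) / (δ * Dmin ^ 4), by positivity, ?_⟩
  intro A hmono hlip S _ ν _ g σR hg hnoise hJ hσR X₁ xstar 𝒳 D hVI hcomp hnhds hlub hD hD' Ω mΩ P _
    ℱ M q Z 𝕃 X Y Xh V hq hrand hrun T hT _ hδ'
  have hor := hnoise.boundedOracle hN hg hJ (hσR.trans (le_max_left _ _)) hσ0 hc₁.le h₁ h₂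
  have hnr := QODA.noisyRun hN hg hrand hrun hK hq hor h₁ h₂ (hlip.norm_sub_le hc₁.le h₁ h₃) hL
  have hmem : xstar ∈ 𝒳 := mem_of_mem_nhds hnhds
  have hD0 : 0 < D := hDmin.trans_le hD
  have hdist : ∀ p ∈ 𝒳, ‖X₁ - p‖ ^ 2 ≤ max Dmax 0 ^ 2 := fun p hp =>
    (hlub.1 ⟨p, hp, rfl⟩).trans
      (pow_le_pow_left₀ hD0.le (hD'.trans (le_max_left _ _)) 2)
  -- The solution `xstar` serves as the comparator with nonnegative regret, by monotonicity and `A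
  -- xstar = 0`.
  obtain ⟨Φ, hΦ, hΦC, hΦle⟩ := hC hnr xstar (hdist xstar hmem) (fun t ht w => by
    have := hmono (Xh t w) xstar
    rwa [hVI.eq_zero, sub_zero, ← QODA.meanFeedback_of_pos A (fun t => Xh t w) ht] at this) T
  have hgap := QODA.EssBdd.gap hor.norm_mean_le hcomp ⟨xstar, hmem⟩
    (x := fun w => QODA.avgIterate (fun t => Xh t w) T) (P := P)
    ((QODA.EssBdd.const _).smul (QODA.EssBdd.sum _ fun t ht =>
      hnr.bdd_Xh (by positivity) hqh' (Finset.mem_Icc.1 ht).1))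
  refine ⟨hgap.integrable, ?_⟩
  have hT0 : (0 : ℝ) < T := by positivity
  set s := σR * QODA.avgεQ P q 𝕃 T + QODA.avgεQ P q 𝕃 T + σR
  have hs : 0 ≤ s := hδ.le.trans hδ'
  calc ∫ w, QODA.gap A 𝒳 (QODA.avgIterate (fun t => Xh t w) T) ∂P
      ≤ ∫ w, Φ w / T ∂P := by
        refine integral_mono hgap.integrable (hΦ.div_const _) fun w => ?_
        refine QODA.gap_avgIterate_le hmono ⟨xstar, hmem⟩ hT fun p hp => ?_
        refine le_trans (le_of_eq (Finset.sum_congr rfl fun t ht => ?_)) (hΦle w p (hdist p hp))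
        rw [QODA.meanFeedback_of_pos A (fun t => Xh t w) (Finset.mem_Icc.1 ht).1]
    _ ≤ (|C| + 1) / T := by
        rw [integral_div]
        gcongr
        linarith [le_abs_self C]
    _ = (|C| + 1) / (δ * Dmin ^ 4) * ((δ * Dmin ^ 4) / T) := by
        field_simp
    -- The claimed rate appears only here, through `δ ≤ s` and `Dmin ≤ D`.
    _ ≤ (|C| + 1) / (δ * Dmin ^ 4) * (s * D ^ 4 / T) := by
        gcongr
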